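/- Let $\mathfrak X$ be a countably infinite alphabet that contains pairwise distinct letters $x,y,t$ and $z_i,y_i,t_i$ ($i\ge 1$), and let $\mathfrak X^*$ be the free monoid over $\mathfrak X$. A letter is simple (multiple) in a word if it occurs in it exactly once (at least twice). For $\mathbf u,\mathbf v\in\mathfrak X^*$ put $\mathbf u\mathrel{\lambda}\mathbf v$ if and only if (1) the same letters are simple in $\mathbf u$ and in $\mathbf v$; (2) $\mathbf u$ can be obtained from $\mathbf v$ by changing the (positive) exponents of the maximal powers of letters in $\mathbf v$; and (3) for each multiple letter, its first two occurrences are adjacent in $\mathbf u$ if and only if they are adjacent in $\mathbf v$. This is a congruence on $\mathfrak X^*$; let $[\mathbf w]^\lambda$ denote the $\lambda$-class of the word $\mathbf w$. For a $\lambda$-class $\mathtt w$, let $M_\lambda(\mathtt w)$ be the Rees quotient of the monoid $\mathfrak X^*/\lambda$ over the ideal of all elements that are not factors of $\mathtt w$ (an element $\mathtt v$ is a factor of $\mathtt w$ if $\mathtt w=\mathtt p\mathtt v\mathtt s$ for some $\mathtt p,\mathtt s\in\mathfrak X^*/\lambda$), and let $\mathbf M_\lambda(\mathtt w)$ be the monoid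 variety generated by $M_\lambda(\mathtt w)$. For an integer $n\ge 1$ and a permutation $\rho$ of $\{1,\dots,n\}$, written $i\mapsto i\rho$, put \[ \mathbf c_{0,0,n}[\rho]:=xyt\,x\biggl(\prod_{i=1}^{n-1} z_{i\rho}y_i^2\biggr)z_{n\rho}\,y\biggl(\prod_{i=1}^{n} t_iz_i\biggr). \] **Proposition.** For every integer $n\ge 1$ and every $\rho\in S_n$, the lattice of subvarieties of the variety $\mathbf M_\lambda([\mathbf c_{0,0,n}[\rho]]^\lambda)$ is not modular. -/

import Mathlib

/-! ### Words -/

/-- The countably infinite alphabet, with letters `x, y, t` and `z_i, y_i, t_i` for `i : ℕ`. -/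
inductive Letter : Type
  | x : Letter
  | y : Letter
  | t : Letter
  | z_ (i : ℕ) : Letter
  | y_ (i : ℕ) : Letter
  | t_ (i : ℕ) : Letter
  deriving DecidableEq

instance : Infinite Letter :=
  Infinite.of_injective Letter.z_ fun _ _ h => Letter.z_.inj h

instance : Countable Letter := by
  let f : Letter → ℕ × ℕ := fun a => match a with
    | .x => (0, 0)
    | .y => (1, 0)
    | .t => (2, 0)
    | .z_ i => (3, i)
    | .y_ i => (4, i)
    | .t_ i => (5, i)
  have hf : Function.Injective f := by
    intro a b h
    cases a <;> cases b <;> simp_all [f]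
  exact hf.countable

/-- Words over the alphabet; the empty word is `1`. -/
abbrev Word : Type := FreeMonoid Letter

/-! ### Varieties of monoids -/

/-- The monoid `M` satisfies the identity `e.1 ≈ e.2`. -/
def SatisfiesIdentity (M : Type) [Monoid M] (e : Word × Word) : Prop :=
  ∀ φ : Letter → M, FreeMonoid.lift φ e.1 = FreeMonoid.lift φ e.2

/-- A variety of monoids: a class of monoids that is given by a set of identities. -/
@[ext]
structure MonoidVariety where
  carrier : Set MonCat.{0}
  equational : ∃ E : Set (Word × Word),
    carrier = {M : MonCat.{0} | ∀ e ∈ E, SatisfiesIdentity M e}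

namespace MonoidVariety

/-- Varieties are ordered by inclusion. -/
instance : PartialOrder MonoidVariety :=
  PartialOrder.lift MonoidVariety.carrier fun _ _ h => MonoidVariety.ext h

/-- The intersection of a family of varieties is a variety. -/
instance : InfSet MonoidVariety where
  sInf S :=
    { carrier := {M | ∀ V ∈ S, M ∈ V.carrier}
      equational := by
        refine ⟨{e | ∃ V ∈ S, ∀ M ∈ V.carrier, SatisfiesIdentity M e}, ?_⟩
        ext M
        constructor
        · rintro hM e ⟨V, hV, he⟩
          exact he M (hM V hV)
        · intro hM V hV
          obtain ⟨E, hE⟩ := V.equational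
          rw [hE]
          intro e he
          refine hM e ⟨V, hV, fun N hN => ?_⟩
          rw [hE] at hN
          exact hN e he }

/-- The lattice of all varieties of monoids: the meet is the intersection, and the join of two
varieties is the least variety that contains both. -/
instance : CompleteLattice MonoidVariety :=
  completeLatticeOfInf MonoidVariety fun _ =>
    ⟨fun _ hV _ hM => hM _ hV, fun _ hW _ hM _ hV => hW hV hM⟩

/-- The variety generated by a monoid, i.e. the least variety that contains it. -/
def generatedBy (M : Type) [Monoid M] : MonoidVariety :=
  sInf {V | MonCat.of M ∈ V.carrier}

/-- The lattice of subvarieties of a variety. -/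
abbrev SubvarietyLattice (V : MonoidVariety) : Type 1 := Set.Iic V

end MonoidVariety

/-! ### Rees quotients and the monoids `M_α(W)` -/

/-- The Rees congruence of a two-sided ideal `I` of a monoid `Q`: the elements of `I` are
identified with each other, and nothing else is. -/
def reesCon {Q : Type} [Monoid Q] (I : Set Q) (hI : ∀ a ∈ I, ∀ p s : Q, p * a * s ∈ I) :
    Con Q where
  r a b := a = b ∨ (a ∈ I ∧ b ∈ I)
  iseqv :=
    { refl := fun _ => Or.inl rfl
      symm := by
        rintro a b (h | h)
        · exact Or.inl h.symm
        · exact Or.inr h.symm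
      trans := by
        rintro a b c (rfl | h) (rfl | h')
        · exact Or.inl rfl
        · exact Or.inr h'
        · exact Or.inr h
        · exact Or.inr ⟨h.1, h'.2⟩ }
  mul' := by
    have hl : ∀ a ∈ I, ∀ p, p * a ∈ I := fun a ha p => by simpa using hI a ha p 1
    have hr : ∀ a ∈ I, ∀ s, a * s ∈ I := fun a ha s => by simpa using hI a ha 1 s
    rintro a b c d (rfl | h) (rfl | h')
    · exact Or.inl rfl
    · exact Or.inr ⟨hl _ h'.1 _, hl _ h'.2 _⟩
    · exact Or.inr ⟨hr _ h.1 _, hr _ h.2 _⟩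
    · exact Or.inr ⟨hr _ h.1 _, hr _ h.2 _⟩

/-- The set `W^≤` of all factors of elements of `W`. -/
def factorClosure {Q : Type} [Monoid Q] (W : Set Q) : Set Q :=
  {v | ∃ u ∈ W, ∃ p s : Q, u = p * v * s}

theorem compl_factorClosure_ideal {Q : Type} [Monoid Q] (W : Set Q) :
    ∀ a ∈ (factorClosure W)ᶜ, ∀ p s : Q, p * a * s ∈ (factorClosure W)ᶜ := by
  rintro a ha p s ⟨u, hu, p', s', rfl⟩
  exact ha ⟨_, hu, p' * p, s * s', by simp only [mul_assoc]⟩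

/-- The monoid `M_α(W)`, where `α` is a congruence on the free monoid and `W` is a set of
`α`-classes: the Rees quotient of the monoid of `α`-classes by the ideal of those `α`-classes
that are not factors of elements of `W`. -/
abbrev MAlpha (α : Con Word) (W : Set α.Quotient) : Type :=
  (reesCon (factorClosure W)ᶜ (compl_factorClosure_ideal W)).Quotient

/-! ### The congruence `λ` -/

/-- The relation `γ`: the same letters are simple (occur exactly once) in `u` and in `v`, and `u`
is obtained from `v` by changing the exponents of the maximal powers of letters, i.e. `u` and `v`
become equal when each maximal block `a ⋯ a` of equal letters is replaced by a single `a`. -/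
def GammaRel (u v : Word) : Prop :=
  (∀ a : Letter, u.toList.count a = 1 ↔ v.toList.count a = 1) ∧
    u.toList.destutter (· ≠ ·) = v.toList.destutter (· ≠ ·)

/-- The letter `a` is multiple in `l` and its first two occurrences in `l` are adjacent. -/
def FirstTwoAdjacent (a : Letter) (l : List Letter) : Prop :=
  ∃ p s : List Letter, a ∉ p ∧ l = p ++ a :: a :: s

/-- The relation `λ`. (Words that are in relation `γ` have the same multiple letters.) -/
def LambdaRel (u v : Word) : Prop :=
  GammaRel u v ∧ ∀ a : Letter, FirstTwoAdjacent a u.toList ↔ FirstTwoAdjacent a v.toList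

theorem destutter_ne_cons (a : Letter) (l : List Letter) :
    (a :: l).destutter (· ≠ ·) =
      if l.head? = some a then l.destutter (· ≠ ·) else a :: l.destutter (· ≠ ·) := by
  cases l with
  | nil => simp
  | cons b l =>
    rw [List.destutter_cons_cons, List.destutter_cons']
    by_cases h : a = b
    · subst h; simp
    · simp [h, Ne.symm h]

theorem head?_destutter_ne (l : List Letter) :
    (l.destutter (· ≠ ·)).head? = l.head? := by
  induction l with
  | nil => simp
  | cons a l ih =>
    rw [destutter_ne_cons]
    split_ifs with h
    · rw [ih, h]; simp
    · simp

theorem getLast?_destutter_ne (l : List Letter) :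
    (l.destutter (· ≠ ·)).getLast? = l.getLast? := by
  induction l with
  | nil => simp
  | cons a l ih =>
    rw [destutter_ne_cons]
    split_ifs with h
    · cases l with
      | nil => simp at h
      | cons b l => rw [ih, List.getLast?_cons_cons]
    · rw [List.getLast?_cons, List.getLast?_cons, ih]

theorem mem_destutter_ne (a : Letter) (l : List Letter) :
    a ∈ l.destutter (· ≠ ·) ↔ a ∈ l := by
  induction l with
  | nil => simp
  | cons b l ih =>
    rw [destutter_ne_cons]
    split_ifs with h
    · have hb : b ∈ l := List.mem_of_mem_head? h
      rw [ih, List.mem_cons]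
      constructor
      · exact Or.inr
      · rintro (rfl | h') <;> assumption
    · rw [List.mem_cons, List.mem_cons, ih]

theorem destutter_ne_append_right (u : List Letter) {v w : List Letter}
    (h : v.destutter (· ≠ ·) = w.destutter (· ≠ ·)) :
    (u ++ v).destutter (· ≠ ·) = (u ++ w).destutter (· ≠ ·) := by
  induction u with
  | nil => simpa using h
  | cons a u ih =>
    rw [List.cons_append, List.cons_append, destutter_ne_cons, destutter_ne_cons, ih,
      ← head?_destutter_ne (u ++ v), ih, head?_destutter_ne]

theorem destutter_ne_append_left (u w : List Letter) :
    (u ++ w).destutter (· ≠ ·) = (u.destutter (· ≠ ·) ++ w).destutter (· ≠ ·) := by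
  induction u with
  | nil => simp
  | cons a u ih =>
    have h1 : ((a :: u) ++ w).destutter (· ≠ ·) =
        (a :: (u.destutter (· ≠ ·) ++ w)).destutter (· ≠ ·) :=
      destutter_ne_append_right [a] ih
    rw [h1, destutter_ne_cons a u]
    split_ifs with h
    · rw [destutter_ne_cons, if_pos]
      rw [List.head?_append, head?_destutter_ne, h]
      rfl
    · rfl

theorem firstTwoAdjacent_append (a : Letter) (u w : List Letter) :
    FirstTwoAdjacent a (u ++ w) ↔
      FirstTwoAdjacent a u ∨
      (u.count a = 1 ∧ u.getLast? = some a ∧ w.head? = some a) ∨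
      (a ∉ u ∧ FirstTwoAdjacent a w) := by
  induction u with
  | nil => simp [FirstTwoAdjacent]
  | cons b u ih =>
    have key : ∀ l : List Letter, FirstTwoAdjacent a (b :: l) ↔
        (b = a ∧ l.head? = some a) ∨ (b ≠ a ∧ FirstTwoAdjacent a l) := by
      intro l
      constructor
      · rintro ⟨p, s, hp, h⟩
        cases p with
        | nil =>
          simp only [List.nil_append, List.cons.injEq] at h
          exact Or.inl ⟨h.1, by rw [h.2]; rfl⟩
        | cons c p =>
          simp only [List.cons_append, List.cons.injEq] at h
          simp only [List.mem_cons, not_or] at hp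
          exact Or.inr ⟨h.1 ▸ Ne.symm hp.1, p, s, hp.2, h.2⟩
      · rintro (⟨rfl, h⟩ | ⟨hb, p, s, hp, rfl⟩)
        · obtain ⟨s, rfl⟩ := List.head?_eq_some_iff.1 h
          exact ⟨[], s, by simp, rfl⟩
        · exact ⟨b :: p, s, by simp [hp, Ne.symm hb], rfl⟩
    rw [List.cons_append, key, key, ih]
    by_cases hb : b = a
    · subst hb
      cases u with
      | nil => simp
      | cons c u =>
        simp only [List.count_cons_self, List.getLast?_cons_cons, List.head?_cons,
          List.cons_append, List.mem_cons, true_or, not_true_eq_false, false_and, or_false,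
          ne_eq, true_and, iff_self_or, and_imp]
        intro h1 h2
        have h3 : b ∈ c :: u := List.mem_of_getLast? h2
        have h4 := List.count_pos_iff.2 h3
        omega
    · cases u with
      | nil => simp [hb, Ne.symm hb, FirstTwoAdjacent]
      | cons c u => simp [hb, Ne.symm hb, List.count_cons]

/-- The congruence `λ` on the free monoid. -/
def lambdaCon : Con Word where
  r := LambdaRel
  iseqv :=
    { refl := fun _ => ⟨⟨fun _ => Iff.rfl, rfl⟩, fun _ => Iff.rfl⟩
      symm := fun h => ⟨⟨fun a => (h.1.1 a).symm, h.1.2.symm⟩, fun a => (h.2 a).symm⟩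
      trans := fun h h' => ⟨⟨fun a => (h.1.1 a).trans (h'.1.1 a), h.1.2.trans h'.1.2⟩,
        fun a => (h.2 a).trans (h'.2 a)⟩ }
  mul' := by
    rintro u v u' v' ⟨⟨h1, h2⟩, h3⟩ ⟨⟨h1', h2'⟩, h3'⟩
    have hm : ∀ a, a ∈ u.toList ↔ a ∈ v.toList := fun a => by
      rw [← mem_destutter_ne, h2, mem_destutter_ne]
    have hm' : ∀ a, a ∈ u'.toList ↔ a ∈ v'.toList := fun a => by
      rw [← mem_destutter_ne, h2', mem_destutter_ne]
    have hl : u.toList.getLast? = v.toList.getLast? := by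
      rw [← getLast?_destutter_ne, h2, getLast?_destutter_ne]
    have hh : u'.toList.head? = v'.toList.head? := by
      rw [← head?_destutter_ne, h2', head?_destutter_ne]
    refine ⟨⟨fun a => ?_, ?_⟩, fun a => ?_⟩
    · have e1 := h1 a
      have e2 := h1' a
      have e3 := hm a
      have e4 := hm' a
      rw [← List.count_pos_iff, ← List.count_pos_iff] at e3 e4
      rw [FreeMonoid.toList_mul, FreeMonoid.toList_mul, List.count_append, List.count_append]
      omega
    · rw [FreeMonoid.toList_mul, FreeMonoid.toList_mul, destutter_ne_append_left, h2,
        ← destutter_ne_append_left]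
      exact destutter_ne_append_right _ h2'
    · rw [FreeMonoid.toList_mul, FreeMonoid.toList_mul, firstTwoAdjacent_append,
        firstTwoAdjacent_append, h3 a, h1 a, hl, hh, hm a, h3' a]

/-- The variety generated by the monoid `M_λ([w]^λ)`. -/
def varMLambda (w : Word) : MonoidVariety :=
  MonoidVariety.generatedBy (MAlpha lambdaCon {(w : lambdaCon.Quotient)})

/-! ### The words `c_{0,0,n}[ρ]` -/

/-- The symmetric group on the set `{1, …, n}`. -/
abbrev SymGroup (n : ℕ) : Type := Equiv.Perm {i : ℕ // 1 ≤ i ∧ i ≤ n}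

/-- The one-letter word `z_i`. -/
def zLetter (i : ℕ) : Word := FreeMonoid.of (Letter.z_ i)

/-- The one-letter word `y_i`. -/
def yLetter (i : ℕ) : Word := FreeMonoid.of (Letter.y_ i)

/-- The one-letter word `t_i`. -/
def tLetter (i : ℕ) : Word := FreeMonoid.of (Letter.t_ i)

/-- The word `x y t x (∏_{i=1}^{n-1} z_{iρ} y_i²) z_{nρ} y (∏_{i=1}^{n} t_i z_i)` for `n ≥ 1`.
The permutation `ρ` of `{1, …, n}` is extended to `ℕ` by fixing all other numbers, and
`List.range' 1 m` is the list `[1, …, m]`. -/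
def cWord (n : ℕ) (ρ : SymGroup n) : Word :=
  let r : ℕ → ℕ := Equiv.Perm.ofSubtype ρ
  FreeMonoid.of Letter.x * FreeMonoid.of Letter.y * FreeMonoid.of Letter.t *
    FreeMonoid.of Letter.x *
    ((List.range' 1 (n - 1)).map fun i => zLetter (r i) * yLetter i ^ 2).prod *
    zLetter (r n) * FreeMonoid.of Letter.y *
    ((List.range' 1 n).map fun i => tLetter i * zLetter i).prod

/-!
Write the word as `c = x y t x R y T`. Applying a substitution to a word over another alphabet and
preceding the result by a fixed word is a *test* for membership in the `λ`-class of `c`. The words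
that pass a test, or each of several tests, form a language whose syntactic monoid generates a
subvariety of `M_λ([c]^λ)`.

The base word is over an alphabet with two copies of each letter and contains `c` over both copies.
For `i, j ∈ {0, 1}` let `u_{i,j}` be the base word in which the first occurrences of `x` and `y` are
interchanged in the first copy if `i = 1` and in the second copy if `j = 1`. In a substitution
instance of these words, such an interchange can change the outcome of a test only if the images of
the two interchanged letters contain `x` and `y`, and then no letter simple in `c` occurs in either
image. So tests in which `x` (or `y`) always comes along with a simple letter are invariant. A word
is guarded if it passes every such test that the base word passes. The further letters of the base
word are chosen such that being guarded prevents most interchanges from changing the projection to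
a copy of the alphabet. Let `A`, `B`, `C` be the varieties given by the guarded words whose
projections to the second copy, to the first copy, and to both copies are in the `λ`-class of `c`.
Then `C ≤ A ∨ B`, and

* `A` satisfies `u_{0,0} ≈ u_{1,0}` and `u_{0,1} ≈ u_{1,1}`,
* `B` satisfies `u_{0,0} ≈ u_{0,1}` and `u_{1,0} ≈ u_{1,1}`,
* `C` satisfies `u_{0,1} ≈ u_{1,1}`, but not `u_{0,0} ≈ u_{1,0}`.

In a modular lattice `C ≤ A ∨ (B ∧ (A ∨ C))`, but the right-hand side satisfies
`u_{0,0} ≈ u_{1,0}`.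
-/

section

open scoped List
open Letter

/-! ### Sublists -/

section Sublists

variable {α β : Type*} {a b : α} {p A B l : List α}

theorem cons_sublist_append_of_mem (ha : a ∈ A) (hp : p <+ B) : a :: p <+ A ++ B :=
  (List.singleton_sublist.2 ha).append hp

theorem cons_sublist_append_iff_of_notMem (ha : a ∉ A) : a :: p <+ A ++ B ↔ a :: p <+ B := by
  induction A with
  | nil => rfl
  | cons b A ih =>
    rw [List.mem_cons, not_or] at ha
    rw [List.cons_append, List.cons_sublist_cons', ih ha.2]
    exact or_iff_left fun h => ha.1 h.1

theorem not_pair_sublist_of_notMem (hb : b ∉ l) : ¬ [a, b] <+ l :=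
  fun h => hb (h.subset (by simp))

theorem pair_sublist_of_append_of_notMem (hb : b ∉ B) (h : [a, b] <+ A ++ B) : [a, b] <+ A := by
  rw [← List.reverse_sublist, List.reverse_append] at h
  rw [← List.reverse_sublist]
  exact (cons_sublist_append_iff_of_notMem (by simpa using hb)).1 h

theorem pair_sublist_or_pair_sublist (hab : a ≠ b) (ha : a ∈ l) (hb : b ∈ l) :
    [a, b] <+ l ∨ [b, a] <+ l := by
  obtain ⟨s, t, rfl⟩ := List.append_of_mem ha
  rcases List.mem_append.1 hb with h | h
  · exact Or.inr (cons_sublist_append_of_mem h (by simp))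
  · have hbt : b ∈ t := (List.mem_cons.1 h).resolve_left hab.symm
    exact Or.inl (List.sublist_append_of_sublist_right (by simpa using hbt))

theorem append_comm_of_forall_eq (h : ∀ c ∈ A, ∀ d ∈ B, c = d) : A ++ B = B ++ A := by
  rcases A with _ | ⟨a, A⟩
  · simp
  rcases B with _ | ⟨b, B⟩
  · simp
  have hab : a = b := h a (by simp) b (by simp)
  have hA : a :: A = List.replicate (A.length + 1) a :=
    List.eq_replicate_iff.2 ⟨by simp, fun c hc => (h c hc b (by simp)).trans hab.symm⟩
  have hB : b :: B = List.replicate (B.length + 1) a :=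
    List.eq_replicate_iff.2 ⟨by simp, fun c hc => (h a (by simp) c hc).symm⟩
  rw [hA, hB, List.replicate_append_replicate, List.replicate_append_replicate, add_comm]

theorem pair_sublist_flatMap {f : α → List β} {c d : β} (h : [c, d] <+ l.flatMap f) :
    (∃ g k, c ∈ f g ∧ d ∈ f k ∧ [g, k] <+ l) ∨ ∃ g ∈ l, [c, d] <+ f g := by
  induction l with
  | nil => simp at h
  | cons a l ih =>
    rw [List.flatMap_cons, List.sublist_append_iff] at h
    obtain ⟨p, q, hpq, hp, hq⟩ := h
    match p, hpq with
    | [], hpq =>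
      rcases ih ((List.nil_append q ▸ hpq) ▸ hq) with ⟨g, k, hc, hd, hgk⟩ | ⟨g, hg, hcd⟩
      · exact Or.inl ⟨g, k, hc, hd, hgk.cons a⟩
      · exact Or.inr ⟨g, List.mem_cons_of_mem a hg, hcd⟩
    | [e], hpq =>
      obtain ⟨rfl, rfl⟩ : c = e ∧ [d] = q := by simpa using hpq
      obtain ⟨k, hk, hd⟩ := List.mem_flatMap.1 (List.singleton_sublist.1 hq)
      exact Or.inl ⟨a, k, List.singleton_sublist.1 hp, hd, by simpa using hk⟩
    | e :: e' :: p, hpq =>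
      obtain ⟨rfl, rfl, rfl, rfl⟩ : c = e ∧ d = e' ∧ p = [] ∧ q = [] := by simpa using hpq
      exact Or.inr ⟨a, by simp, hp⟩

theorem sublist_flatMap_of_map_sublist {f : α → List β} {ι : β → α} {q : List β}
    (hf : ∀ c ∈ q, f (ι c) = [c]) (h : q.map ι <+ l) : q <+ l.flatMap f := by
  have himage : (q.map ι).flatMap f = q := by
    rw [List.flatMap_map, List.flatMap_congr hf, List.flatMap_singleton']
  exact himage ▸ h.flatMap f

theorem two_le_count_flatMap [DecidableEq α] [DecidableEq β] {f : α → List β} {c : β}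
    (ha : 2 ≤ l.count a) (hc : c ∈ f a) : 2 ≤ (l.flatMap f).count c := by
  have hsub := ((List.replicate_sublist_iff.2 ha).flatMap f).count_le c
  have hpos := List.count_pos_iff.2 hc
  simp only [List.replicate, List.flatMap_cons, List.flatMap_nil, List.append_nil,
    List.count_append] at hsub
  omega

end Sublists

/-! ### Lists of letters in relation `λ` -/

theorem sublist_destutter_ne {p l : List Letter} (hp : p.IsChain (· ≠ ·)) (h : p <+ l) :
    p <+ l.destutter (· ≠ ·) := by
  induction l generalizing p with
  | nil => simpa using h
  | cons a l ih =>
    rw [destutter_ne_cons]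
    rw [List.sublist_cons_iff] at h
    split_ifs with ha
    · obtain ⟨s, rfl⟩ := List.head?_eq_some_iff.1 ha
      rcases h with h | ⟨r, rfl, h⟩
      · exact ih hp h
      · refine ih hp ?_
        rcases r with _ | ⟨b, r⟩
        · simp
        · have hba : b ≠ a := (List.isChain_cons_cons.1 hp).1.symm
          exact (List.Sublist.of_cons_of_ne hba h).cons_cons a
    · rcases h with h | ⟨r, rfl, h⟩
      · exact (ih hp h).cons a
      · exact (ih hp.of_cons h).cons_cons a

theorem exists_sublist_of_not_firstTwoAdjacent {a : Letter} {l p : List Letter}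
    (h : ¬ FirstTwoAdjacent a l) (hp : a :: a :: p <+ l) :
    ∃ c, c ≠ a ∧ a :: c :: a :: p <+ l := by
  obtain ⟨q, s, rfl, hq⟩ := List.eq_append_cons_of_mem (hp.subset List.mem_cons_self)
  rw [cons_sublist_append_iff_of_notMem hq, List.cons_sublist_cons] at hp
  rcases s with _ | ⟨c, s⟩
  · simp at hp
  have hc : c ≠ a := by
    rintro rfl
    exact h ⟨q, s, hq, rfl⟩
  exact ⟨c, hc, List.sublist_append_of_sublist_right
    (((List.Sublist.of_cons_of_ne hc.symm hp).cons_cons c).cons_cons a)⟩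

/-- The relation `λ` for lists of letters. -/
def ListLambda (L D : List Letter) : Prop :=
  LambdaRel (FreeMonoid.ofList L) (FreeMonoid.ofList D)

namespace ListLambda

variable {L D p : List Letter} {a : Letter}

theorem refl (L : List Letter) : ListLambda L L := lambdaCon.refl _

theorem symm (h : ListLambda L D) : ListLambda D L := lambdaCon.symm h

theorem destutter_eq (h : ListLambda L D) :
    L.destutter (· ≠ ·) = D.destutter (· ≠ ·) := h.1.2

theorem sublist (h : ListLambda L D) (hp : p.IsChain (· ≠ ·)) (hL : p <+ L) : p <+ D :=
  (h.destutter_eq ▸ sublist_destutter_ne hp hL).trans (List.destutter_sublist _ _)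

theorem mem_iff (h : ListLambda L D) : a ∈ L ↔ a ∈ D := by
  rw [← mem_destutter_ne, h.destutter_eq, mem_destutter_ne]

theorem count_eq_one (h : ListLambda L D) (ha : D.count a = 1) : L.count a = 1 :=
  (h.1.1 a).2 ha

theorem sublist_of_not_firstTwoAdjacent (h : ListLambda L D) (ha : ¬ FirstTwoAdjacent a D)
    (hp : (a :: p).IsChain (· ≠ ·)) (hL : a :: a :: p <+ L) : a :: a :: p <+ D := by
  obtain ⟨c, hc, hcL⟩ := exists_sublist_of_not_firstTwoAdjacent (mt (h.2 a).1 ha) hL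
  have hcD := h.sublist ((hp.cons_cons hc).cons_cons hc.symm) hcL
  exact ((List.sublist_cons_self c (a :: p)).cons_cons a).trans hcD

end ListLambda

/-! ### Subwords of the words `c_{0,0,n}[ρ]` -/

/-- The word `x y t x R y T`, of which `c_{0,0,n}[ρ]` is a special case. -/
def cList (R T : List Letter) : List Letter :=
  x :: y :: t :: x :: (R ++ y :: T)

/-- The combinatorial properties shared by the two blocks `R = z_{1ρ} y_1² ⋯ y_{n-1}² z_{nρ}` and
`T = t_1 z_1 ⋯ t_n z_n` of the words `c_{0,0,n}[ρ] = x y t x R y T`. -/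
structure IsCBlock (R T : List Letter) : Prop where
  mem_left : ∀ c ∈ R, (∃ i, c = z_ i) ∨ ∃ k, c = y_ k
  mem_right : ∀ c ∈ T, (∃ i, c = z_ i) ∨ ∃ i, c = t_ i
  z_mem_left_iff : ∀ i, z_ i ∈ R ↔ t_ i ∈ T
  z_mem_right_iff : ∀ i, z_ i ∈ T ↔ t_ i ∈ T
  count_z_left : ∀ i, R.count (z_ i) ≤ 1
  split_y : ∀ k, y_ k ∈ R → ∃ A B, R = A ++ y_ k :: y_ k :: B ∧ y_ k ∉ A ∧ y_ k ∉ B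
  split_t : ∀ i, t_ i ∈ T → ∃ A B, T = A ++ t_ i :: z_ i :: B ∧
    t_ i ∉ A ∧ z_ i ∉ A ∧ t_ i ∉ B ∧ z_ i ∉ B
  head_left : ∃ f R', R = z_ f :: R'
  head_right : ∃ j T', T = t_ j :: T'
  last_left : ∃ k R', R = R' ++ [z_ k]

/-- The word `(∏_{i ∈ l} z_{r i} y_i²) z_{r m}`. -/
def cMiddle (r : ℕ → ℕ) (l : List ℕ) (m : ℕ) : List Letter :=
  (l.flatMap fun i => [z_ (r i), y_ i, y_ i]) ++ [z_ (r m)]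

/-- The word `∏_{i ∈ l} t_i z_i`. -/
def cTail (l : List ℕ) : List Letter := l.flatMap fun i => [t_ i, z_ i]

theorem mem_cMiddle {r : ℕ → ℕ} {l : List ℕ} {m : ℕ} {c : Letter} :
    c ∈ cMiddle r l m ↔ (∃ i ∈ l ++ [m], c = z_ (r i)) ∨ ∃ i ∈ l, c = y_ i := by
  simp only [cMiddle, List.mem_append, List.mem_flatMap, List.mem_cons, List.not_mem_nil]
  grind

theorem mem_cTail {l : List ℕ} {c : Letter} :
    c ∈ cTail l ↔ (∃ i ∈ l, c = z_ i) ∨ ∃ i ∈ l, c = t_ i := by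
  simp only [cTail, List.mem_flatMap, List.mem_cons, List.not_mem_nil]
  grind

theorem count_z_cMiddle (r : ℕ → ℕ) (l : List ℕ) (m i : ℕ) :
    (cMiddle r l m).count (z_ i) = ((l ++ [m]).map r).count i := by
  induction l with
  | nil => simp [cMiddle, List.count_cons]
  | cons j l ih => simpa [cMiddle, List.count_cons] using ih

theorem exists_split_of_nodup {α : Type*} {l : List α} (hl : l.Nodup) {a : α} (ha : a ∈ l) :
    ∃ A B, l = A ++ a :: B ∧ a ∉ A ∧ a ∉ B := by
  obtain ⟨A, B, rfl, hA⟩ := List.eq_append_cons_of_mem ha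
  exact ⟨A, B, rfl, hA, (List.nodup_cons.1 (List.nodup_append.1 hl).2.1).1⟩

theorem cMiddle_split_y {r : ℕ → ℕ} {l : List ℕ} {m k : ℕ} (hl : l.Nodup)
    (hk : y_ k ∈ cMiddle r l m) :
    ∃ A B, cMiddle r l m = A ++ y_ k :: y_ k :: B ∧ y_ k ∉ A ∧ y_ k ∉ B := by
  obtain ⟨A, B, rfl, hA, hB⟩ := exists_split_of_nodup hl (by simpa [mem_cMiddle] using hk)
  exact ⟨cMiddle r A k, cMiddle r B m, by simp [cMiddle], by simpa [mem_cMiddle] using hA,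
    by simpa [mem_cMiddle] using hB⟩

theorem cTail_split_t {l : List ℕ} {i : ℕ} (hl : l.Nodup) (hi : t_ i ∈ cTail l) :
    ∃ A B, cTail l = A ++ t_ i :: z_ i :: B ∧ t_ i ∉ A ∧ z_ i ∉ A ∧ t_ i ∉ B ∧ z_ i ∉ B := by
  obtain ⟨A, B, rfl, hA, hB⟩ := exists_split_of_nodup hl (by simpa [mem_cTail] using hi)
  exact ⟨cTail A, cTail B, by simp [cTail], by simp [mem_cTail, hA, hB]⟩

theorem isCBlock_cMiddle_cTail {r : ℕ → ℕ} (hr : r.Injective) {l l' : List ℕ} {m : ℕ}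
    (hl : (l ++ [m]).Nodup) (hl' : l'.Nodup) (hmem : ∀ i, i ∈ l' ↔ i ∈ (l ++ [m]).map r) :
    IsCBlock (cMiddle r l m) (cTail l') where
  mem_left c hc := by rw [mem_cMiddle] at hc; grind
  mem_right c hc := by rw [mem_cTail] at hc; grind
  z_mem_left_iff i := by simp [mem_cMiddle, mem_cTail, hmem, eq_comm]
  z_mem_right_iff i := by simp only [mem_cTail]; grind
  count_z_left i := by
    rw [count_z_cMiddle]
    exact List.nodup_iff_count_le_one.1 (hl.map hr) i
  split_y k := cMiddle_split_y hl.of_append_left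
  split_t i := cTail_split_t hl'
  head_left := by rcases l with _ | ⟨i, l⟩ <;> exact ⟨_, _, rfl⟩
  head_right := by
    rcases l' with _ | ⟨j, l'⟩
    · simpa using hmem (r m)
    · exact ⟨_, _, rfl⟩
  last_left := ⟨_, _, rfl⟩

theorem ofSubtype_mem_Icc_iff {n : ℕ} (ρ : SymGroup n) (i : ℕ) :
    (1 ≤ Equiv.Perm.ofSubtype ρ i ∧ Equiv.Perm.ofSubtype ρ i ≤ n) ↔ 1 ≤ i ∧ i ≤ n :=
  Equiv.Perm.ofSubtype_apply_mem_iff_mem ρ i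

theorem toList_cWord (n : ℕ) (ρ : SymGroup n) : (cWord n ρ).toList =
    cList (cMiddle (Equiv.Perm.ofSubtype ρ) (List.range' 1 (n - 1)) n)
      (cTail (List.range' 1 n)) := by
  simp [cWord, cList, cMiddle, cTail, zLetter, yLetter, tLetter, FreeMonoid.toList_prod,
    List.flatMap_def, Function.comp_def, pow_two]

theorem isCBlock_cWord {n : ℕ} (hn : 1 ≤ n) (ρ : SymGroup n) :
    IsCBlock (cMiddle (Equiv.Perm.ofSubtype ρ) (List.range' 1 (n - 1)) n)
      (cTail (List.range' 1 n)) := by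
  have hrange : List.range' 1 (n - 1) ++ [n] = List.range' 1 n := by
    obtain ⟨m, rfl⟩ := Nat.exists_eq_add_of_le' hn
    simp [List.range'_concat, add_comm]
  refine isCBlock_cMiddle_cTail (Equiv.injective _) (hrange ▸ List.nodup_range') List.nodup_range'
    fun i => ?_
  rw [hrange]
  simp only [List.mem_map, List.mem_range'_1, Nat.lt_one_add_iff]
  refine ⟨fun hi => ⟨(Equiv.Perm.ofSubtype ρ).symm i, ?_, Equiv.apply_symm_apply _ i⟩, ?_⟩
  · rwa [← ofSubtype_mem_Icc_iff ρ, Equiv.apply_symm_apply]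
  · rintro ⟨j, hj, rfl⟩
    exact (ofSubtype_mem_Icc_iff ρ j).2 hj

namespace IsCBlock

variable {R T : List Letter} {c : Letter} {i k : ℕ}

theorem notMem_left (h : IsCBlock R T) (hz : ∀ i, c ≠ z_ i) (hy : ∀ k, c ≠ y_ k) : c ∉ R :=
  fun hc => (h.mem_left c hc).elim (fun ⟨i, hi⟩ => hz i hi) fun ⟨k, hk⟩ => hy k hk

theorem notMem_right (h : IsCBlock R T) (hz : ∀ i, c ≠ z_ i) (ht : ∀ i, c ≠ t_ i) : c ∉ T :=
  fun hc => (h.mem_right c hc).elim (fun ⟨i, hi⟩ => hz i hi) fun ⟨i, hi⟩ => ht i hi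

theorem mem_cList (h : IsCBlock R T) (hc : c ∈ cList R T) :
    c = x ∨ c = y ∨ c = t ∨ (∃ i, t_ i ∈ T ∧ (c = z_ i ∨ c = t_ i)) ∨
      ∃ k, y_ k ∈ R ∧ c = y_ k := by
  have hleft := h.mem_left c
  have hright := h.mem_right c
  have hz := h.z_mem_left_iff
  have hz' := h.z_mem_right_iff
  simp only [cList, List.mem_cons, List.mem_append] at hc
  grind

theorem split_z (h : IsCBlock R T) (hi : z_ i ∈ R) :
    ∃ A B, R = A ++ z_ i :: B ∧ z_ i ∉ A ∧ z_ i ∉ B := by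
  obtain ⟨A, B, rfl, hA⟩ := List.eq_append_cons_of_mem hi
  have hcount := h.count_z_left i
  rw [List.count_append, List.count_cons_self] at hcount
  exact ⟨A, B, rfl, hA, List.count_eq_zero.1 (by omega)⟩

theorem count_t (h : IsCBlock R T) : (cList R T).count t = 1 := by
  have hR : R.count t = 0 := List.count_eq_zero.2 (h.notMem_left (by simp) (by simp))
  have hT : T.count t = 0 := List.count_eq_zero.2 (h.notMem_right (by simp) (by simp))
  simp [cList, List.count_append, hR, hT]

theorem count_t_ (h : IsCBlock R T) (hi : t_ i ∈ T) : (cList R T).count (t_ i) = 1 := by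
  have hR : R.count (t_ i) = 0 := List.count_eq_zero.2 (h.notMem_left (by simp) (by simp))
  obtain ⟨A, B, rfl, hA, -, hB, -⟩ := h.split_t i hi
  simp [cList, hR, List.count_eq_zero.2 hA, List.count_eq_zero.2 hB]

theorem z_y_sublist (hi : z_ i ∈ R) : [z_ i, y] <+ cList R T := by
  have : [z_ i, y] <+ R ++ y :: T := cons_sublist_append_of_mem hi (by simp)
  exact (this.cons x).cons t |>.cons y |>.cons x

theorem not_firstTwoAdjacent_y : ¬ FirstTwoAdjacent y (cList R T) := by
  rintro ⟨_ | ⟨a, _ | ⟨b, p⟩⟩, s, hp, heq⟩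
  · simp [cList] at heq
  · simp [cList] at heq
  · simp only [cList, List.cons_append, List.cons.injEq] at heq
    exact hp (by simp [← heq.2.1])

theorem not_firstTwoAdjacent_z (h : IsCBlock R T) (hi : z_ i ∈ R) :
    ¬ FirstTwoAdjacent (z_ i) (cList R T) := by
  obtain ⟨A, B, rfl, hA, hB⟩ := h.split_z hi
  have hsplit : cList (A ++ z_ i :: B) T = (x :: y :: t :: x :: A ++ [z_ i]) ++ (B ++ y :: T) := by
    simp [cList]
  have hprefix : ¬ FirstTwoAdjacent (z_ i) (x :: y :: t :: x :: A ++ [z_ i]) := by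
    rw [firstTwoAdjacent_append]
    rintro (⟨p, s, -, heq⟩ | ⟨hcount, -⟩ | ⟨-, p, s, -, heq⟩)
    · have hmem : z_ i ∈ x :: y :: t :: x :: A := heq ▸ by simp
      simp [hA] at hmem
    · have hmem : z_ i ∈ x :: y :: t :: x :: A := List.count_pos_iff.1 (by omega)
      simp [hA] at hmem
    · have hlength := congrArg List.length heq
      simp only [List.length_append, List.length_cons, List.length_nil] at hlength
      omega
  rw [hsplit, firstTwoAdjacent_append]
  rintro (h' | ⟨-, -, hhead⟩ | ⟨hnot, -⟩)
  · exact hprefix h'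
  · rcases B with _ | ⟨b, B⟩
    · simp at hhead
    · simp only [List.cons_append, List.head?_cons, Option.some.injEq] at hhead
      exact hB (by simp [hhead])
  · simp at hnot

section NotSublist

attribute [local simp] cList List.cons_sublist_cons' cons_sublist_append_iff_of_notMem
  not_pair_sublist_of_notMem

theorem eq_of_x_c_x (h : IsCBlock R T) (hc : [x, c, x] <+ cList R T) : c = y ∨ c = t := by
  have hx : x ∉ R ++ y :: T := by simp [h.notMem_left, h.notMem_right]
  simpa [hx, or_comm] using hc

theorem not_pair_x (h : IsCBlock R T) (hx : c ≠ x) (hy : c ≠ y) (ht : c ≠ t) :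
    ¬ [c, x] <+ cList R T := by
  simp [h.notMem_left, h.notMem_right, hx, hy, ht]

theorem not_pair_t (h : IsCBlock R T) (hx : c ≠ x) (hy : c ≠ y) (ht : c ≠ t) :
    ¬ [c, t] <+ cList R T := by
  simp [h.notMem_left, h.notMem_right, hx, hy, ht]

theorem not_y_y_x (h : IsCBlock R T) : ¬ [y, y, x] <+ cList R T := by
  simp [h.notMem_left, h.notMem_right]

theorem not_y_x_t (h : IsCBlock R T) : ¬ [y, x, t] <+ cList R T := by
  simp [h.notMem_left, h.notMem_right]

theorem not_t_y_x (h : IsCBlock R T) : ¬ [t, y, x] <+ cList R T := by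
  simp [h.notMem_left, h.notMem_right]

theorem not_t_y_y (h : IsCBlock R T) : ¬ [t, y, y] <+ cList R T := by
  simp [h.notMem_left, h.notMem_right]

theorem not_y_y_y (h : IsCBlock R T) : ¬ [y, y, y] <+ cList R T := by
  simp [h.notMem_left, h.notMem_right]

theorem not_y_y_y_ (h : IsCBlock R T) : ¬ [y, y, y_ k] <+ cList R T := by
  simp [h.notMem_left, h.notMem_right]

theorem not_t_y (h : IsCBlock R T) : ¬ [t_ i, y] <+ cList R T := by
  simp [h.notMem_left, h.notMem_right]

theorem not_y_c_y_ (h : IsCBlock R T) (hk : y_ k ∈ R) (hc : c ≠ y_ k) :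
    ¬ [y_ k, c, y_ k] <+ cList R T := by
  obtain ⟨A, B, hR, hA, hB⟩ := h.split_y k hk
  have hT : y_ k ∉ T := h.notMem_right (by simp) (by simp)
  simp [hR, hA, hB, hT, hc]

theorem not_z_z_y (h : IsCBlock R T) (hi : z_ i ∈ R) : ¬ [z_ i, z_ i, y] <+ cList R T := by
  obtain ⟨A, B, hR, hA, hB⟩ := h.split_z hi
  simp [hR, hA, hB, h.notMem_right]

theorem not_z_z_t (h : IsCBlock R T) (hi : t_ i ∈ T) : ¬ [z_ i, z_ i, t_ i] <+ cList R T := by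
  have ht : t_ i ∉ R := h.notMem_left (by simp) (by simp)
  obtain ⟨A, B, rfl, hA, hB⟩ := h.split_z ((h.z_mem_left_iff i).2 hi)
  obtain ⟨A', B', hT, hA', hzA', hB', -⟩ := h.split_t i hi
  simp_all

theorem not_t_c_z (h : IsCBlock R T) (hi : t_ i ∈ T) (hc : c ≠ z_ i) :
    ¬ [t_ i, c, z_ i] <+ cList R T := by
  obtain ⟨A, B, hT, hA, -, -, hB⟩ := h.split_t i hi
  simp [h.notMem_left, hT, hA, hB, hc]

end NotSublist

end IsCBlock

/-! ### Interchanging two adjacent factors -/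

/-- A word context `P _ Q X B Y S` with a hole. Filling the hole with `X Y` or with `Y X` gives the
two sides of an identity that interchanges the factors `X` and `Y`, which occur once more, in this
order and separated by `B`, on the right of the hole. -/
structure SwapFrame (α : Type*) where
  P : List α
  Q : List α
  X : List α
  B : List α
  Y : List α
  S : List α

namespace SwapFrame

variable {α β : Type*}

/-- The word obtained by filling the hole with `M`. -/
def fill (F : SwapFrame α) (M : List α) : List α :=
  F.P ++ (M ++ (F.Q ++ (F.X ++ (F.B ++ (F.Y ++ F.S)))))

/-- The image of a frame under a substitution, preceded by `p` and followed by `s`. -/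
def bind (p s : List β) (f : α → List β) (F : SwapFrame α) : SwapFrame β where
  P := p ++ F.P.flatMap f
  Q := F.Q.flatMap f
  X := F.X.flatMap f
  B := F.B.flatMap f
  Y := F.Y.flatMap f
  S := F.S.flatMap f ++ s

theorem fill_bind (p s : List β) (f : α → List β) (F : SwapFrame α) (M : List α) :
    (F.bind p s f).fill (M.flatMap f) = p ++ ((F.fill M).flatMap f ++ s) := by
  simp [fill, bind, List.flatMap_append]

theorem mem_of_count_fill_eq_one [DecidableEq α] {F : SwapFrame α} {M : List α} {s : α}
    (hM : ∀ c, c ∈ M ↔ c ∈ F.X ∨ c ∈ F.Y) (hB : ∀ c ∈ F.B, (F.fill M).count c ≠ 1)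
    (hs : (F.fill M).count s = 1) :
    s ∉ F.X ∧ s ∉ F.Y ∧ (s ∈ F.P ∨ s ∈ F.Q ∨ s ∈ F.S) := by
  have hmem : s ∈ F.fill M := List.count_pos_iff.1 (by omega)
  have hB' : s ∉ F.B := fun h => hB s h hs
  have hXY : s ∉ F.X ∧ s ∉ F.Y := by
    by_contra! hXY
    have hsM : 0 < M.count s := List.count_pos_iff.2 ((hM s).2 (by tauto))
    have hsXY : 0 < F.X.count s ∨ 0 < F.Y.count s := by
      rw [List.count_pos_iff, List.count_pos_iff]
      tauto
    simp only [fill, List.count_append] at hs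
    omega
  simp only [fill, List.mem_append, hM, hXY, hB', false_or] at hmem
  exact ⟨hXY.1, hXY.2, hmem⟩

theorem triple_sublist_fill {F : SwapFrame α} {M : List α} {b c d : α} (hb : b ∈ M)
    (hc : c ∈ F.X) (hd : d ∈ F.Y) : [b, c, d] <+ F.fill M := by
  unfold fill
  solve_by_elim (maxDepth := 20) [cons_sublist_append_of_mem, List.sublist_append_of_sublist_right,
    List.nil_sublist]

end SwapFrame

/-- A frame whose hole is filled with a word `M` in the letters of its two factors, such that these
factors are separated by multiple letters only and the resulting word is in relation `λ` with the
word `x y t x R y T`. -/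
structure LambdaFilling (R T : List Letter) (F : SwapFrame Letter) (M : List Letter) : Prop where
  lambda : ListLambda (F.fill M) (cList R T)
  mem_iff : ∀ c, c ∈ M ↔ c ∈ F.X ∨ c ∈ F.Y
  not_simple : ∀ c ∈ F.B, (F.fill M).count c ≠ 1

namespace LambdaFilling

variable {R T M : List Letter} {F : SwapFrame Letter} {c d s : Letter} {i k : ℕ}

theorem mem_of_simple (H : LambdaFilling R T F M) (hs : (cList R T).count s = 1) :
    s ∉ F.X ∧ s ∉ F.Y ∧ (s ∈ F.P ∨ s ∈ F.Q ∨ s ∈ F.S) :=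
  SwapFrame.mem_of_count_fill_eq_one H.mem_iff H.not_simple (H.lambda.count_eq_one hs)

theorem alternating_sublist (H : LambdaFilling R T F M) (hc : c ∈ F.X) (hd : d ∈ F.Y)
    (hcd : c ≠ d) : [d, c, d] <+ cList R T :=
  H.lambda.sublist (by simp [hcd, hcd.symm])
    (SwapFrame.triple_sublist_fill ((H.mem_iff d).2 (.inr hd)) hc hd)

theorem doubled_sublist (H : LambdaFilling R T F M) (hc : c ∈ F.X) (hd : d ∈ F.Y)
    (hcd : c ≠ d) (hnot : ¬ FirstTwoAdjacent c (cList R T)) : [c, c, d] <+ cList R T :=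
  H.lambda.sublist_of_not_firstTwoAdjacent hnot (by simp [hcd])
    (SwapFrame.triple_sublist_fill ((H.mem_iff c).2 (.inl hc)) hc hd)

theorem x_notMem_right (H : LambdaFilling R T F M) (h : IsCBlock R T) (hc : c ∈ F.X)
    (hcx : c ≠ x) : x ∉ F.Y := by
  intro hx
  rcases h.eq_of_x_c_x (H.alternating_sublist hc hx hcx) with rfl | rfl
  · exact h.not_y_y_x (H.doubled_sublist hc hx hcx IsCBlock.not_firstTwoAdjacent_y)
  · exact (H.mem_of_simple h.count_t).1 hc

theorem z_notMem_right (H : LambdaFilling R T F M) (h : IsCBlock R T) (hi : t_ i ∈ T)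
    (hc : c ∈ F.X) (hcz : c ≠ z_ i) : z_ i ∉ F.Y := by
  intro hz
  obtain ⟨htX, -, htP⟩ := H.mem_of_simple (h.count_t_ hi)
  have hct : c ≠ t_ i := ne_of_mem_of_not_mem hc htX
  have hzM := (H.mem_iff _).2 (.inr hz)
  have htcz : ¬ [t_ i, c, z_ i] <+ F.fill M := fun hsub =>
    h.not_t_c_z hi hcz (H.lambda.sublist (by simp [hcz, hct.symm]) hsub)
  have hzczt : ¬ [z_ i, c, z_ i, t_ i] <+ F.fill M := fun hsub =>
    h.not_z_z_t hi (((List.sublist_cons_self c _).cons_cons (z_ i)).trans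
      (H.lambda.sublist (by simp [hcz, hcz.symm]) hsub))
  unfold SwapFrame.fill at htcz hzczt
  rcases htP with ht | ht | ht <;> [apply htcz; apply htcz; apply hzczt] <;>
    solve_by_elim (maxDepth := 20) [cons_sublist_append_of_mem,
      List.sublist_append_of_sublist_right, List.nil_sublist, List.singleton_sublist.2]

theorem y_notMem_right (H : LambdaFilling R T F M) (h : IsCBlock R T) (hk : y_ k ∈ F.X) :
    y ∉ F.Y := by
  intro hy
  have hyM := (H.mem_iff _).2 (.inr hy)
  have hkM := (H.mem_iff _).2 (.inl hk)
  have hty : ¬ [t, y, y_ k, y] <+ F.fill M := fun hsub =>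
    h.not_t_y_y ((((List.sublist_cons_self (y_ k) _).cons_cons y).cons_cons t).trans
      (H.lambda.sublist (by simp) hsub))
  have hkt : ¬ [y_ k, t] <+ F.fill M := fun hsub =>
    h.not_pair_t (by simp) (by simp) (by simp) (H.lambda.sublist (by simp) hsub)
  have htP := (H.mem_of_simple h.count_t).2.2
  unfold SwapFrame.fill at hty hkt
  rcases htP with ht | ht | ht <;> [apply hty; apply hkt; apply hkt] <;>
    solve_by_elim (maxDepth := 20) [cons_sublist_append_of_mem,
      List.sublist_append_of_sublist_right, List.nil_sublist, List.singleton_sublist.2]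

theorem eq_x_of_y_mem_right (H : LambdaFilling R T F M) (h : IsCBlock R T) (hc : c ∈ F.X)
    (hy : y ∈ F.Y) (hcy : c ≠ y) : c = x := by
  have hcD : c ∈ cList R T := (H.alternating_sublist hc hy hcy).subset (by simp)
  rcases h.mem_cList hcD with rfl | rfl | rfl | ⟨i, hi, rfl | rfl⟩ | ⟨k, -, rfl⟩
  · rfl
  · exact absurd rfl hcy
  · exact absurd hc (H.mem_of_simple h.count_t).1
  · have hiR := (h.z_mem_left_iff i).2 hi
    exact absurd (H.doubled_sublist hc hy hcy (h.not_firstTwoAdjacent_z hiR)) (h.not_z_z_y hiR)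
  · exact absurd hc (H.mem_of_simple (h.count_t_ hi)).1
  · exact absurd hy (H.y_notMem_right h hc)

theorem eq_x_and_eq_y (H : LambdaFilling R T F M) (h : IsCBlock R T) (hc : c ∈ F.X)
    (hd : d ∈ F.Y) (hcd : c ≠ d) : c = x ∧ d = y := by
  have hdcd := H.alternating_sublist hc hd hcd
  have hdD : d ∈ cList R T := hdcd.subset (by simp)
  rcases h.mem_cList hdD with rfl | rfl | rfl | ⟨i, hi, rfl | rfl⟩ | ⟨k, hk, rfl⟩
  · exact absurd hd (H.x_notMem_right h hc hcd)
  · exact ⟨H.eq_x_of_y_mem_right h hc hd hcd, rfl⟩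
  · exact absurd hd (H.mem_of_simple h.count_t).2.1
  · exact absurd hd (H.z_notMem_right h hi hc hcd)
  · exact absurd hd (H.mem_of_simple (h.count_t_ hi)).2.1
  · exact absurd hdcd (h.not_y_c_y_ hk hcd)

theorem append_comm_or_mem (H : LambdaFilling R T F M) (h : IsCBlock R T) :
    F.X ++ F.Y = F.Y ++ F.X ∨ (x ∈ F.X ∧ y ∈ F.Y) := by
  by_contra! hne
  refine hne.1 (append_comm_of_forall_eq fun c hc d hd => ?_)
  by_contra hcd
  obtain ⟨rfl, rfl⟩ := H.eq_x_and_eq_y h hc hd hcd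
  exact hne.2 hc hd

theorem append_comm_of_swapped (H : LambdaFilling R T F (F.Y ++ F.X)) (h : IsCBlock R T) :
    F.X ++ F.Y = F.Y ++ F.X := by
  rcases H.append_comm_or_mem h with hcomm | ⟨hx, hy⟩
  · exact hcomm
  have htyx : ¬ [t, y, x] <+ F.fill (F.Y ++ F.X) := fun hsub =>
    h.not_t_y_x (H.lambda.sublist (by simp) hsub)
  have hyxt : ¬ [y, x, t] <+ F.fill (F.Y ++ F.X) := fun hsub =>
    h.not_y_x_t (H.lambda.sublist (by simp) hsub)
  have htP := (H.mem_of_simple h.count_t).2.2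
  simp only [SwapFrame.fill, List.append_assoc] at htyx hyxt
  exfalso
  rcases htP with ht | ht | ht <;> [apply htyx; apply hyxt; apply hyxt] <;>
    solve_by_elim (maxDepth := 20) [cons_sublist_append_of_mem,
      List.sublist_append_of_sublist_right, List.nil_sublist, List.singleton_sublist.2]

end LambdaFilling

/-! ### Tests for words over a doubled alphabet -/

/-- An alphabet that consists of two copies `a c` and `b c` of the original one and of seven
further letters. -/
inductive DLetter : Type
  | a (c : Letter) : DLetter
  | b (c : Letter) : DLetter
  | u : DLetter
  | v : DLetter
  | w : DLetter
  | p : DLetter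
  | p' : DLetter
  | q : DLetter
  | q' : DLetter
  deriving DecidableEq, Countable

namespace DLetter

/-- The first (`i = false`) or the second (`i = true`) copy of a letter. -/
def copy : Bool → Letter → DLetter
  | false => a
  | true => b

theorem copy_injective (i : Bool) : Function.Injective (copy i) := by
  cases i
  · exact fun _ _ => a.inj
  · exact fun _ _ => b.inj

end DLetter

open DLetter

/-- The word `u X₁ t v p x X₂ v R y p' T t' x' w u R' y' q w q' T'`, where `x', y', t', R', T'`
are letters and words over the second copy of the alphabet. It contains the words `x y t x R y T`
over both copies when `X₁ = x y` and `X₂ = x' y'`. -/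
def doubleWord (R T : List Letter) (X₁ X₂ : List DLetter) : List DLetter :=
  u :: (X₁ ++ (a t :: v :: p :: a x :: (X₂ ++ (v :: (R.map a ++ (a y :: p' :: (T.map a ++
    (b t :: b x :: w :: u :: (R.map b ++ (b y :: q :: w :: q' :: T.map b))))))))))

/-- The word `doubleWord R T (x y) (x' y')`. -/
def baseWord (R T : List Letter) : List DLetter :=
  doubleWord R T [a x, a y] [b x, b y]

/-- A test for words over `DLetter`: a word passes the test if its image, preceded by `pre`,
is in relation `λ` with a given word `D`. -/
structure WordTest where
  pre : List Letter
  map : DLetter → List Letter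

/-- The test that replaces the first component of each entry of a table by the second one and
deletes all other letters. -/
def WordTest.ofTable (pre : List Letter) (L : List (DLetter × List Letter)) : WordTest where
  pre := pre
  map g := L.flatMap fun e => if e.1 = g then e.2 else []

/-- The projection to a copy of the alphabet. -/
def WordTest.proj (i : Bool) : WordTest where
  pre := []
  map
    | a c => if i then [] else [c]
    | b c => if i then [c] else []
    | _ => []

namespace WordTest

variable {D : List Letter} {τ : WordTest} {l : List DLetter} {α β : DLetter} {c d : Letter}

/-- The image of `l`, preceded by `τ.pre`, is in relation `λ` with `D`. -/
def Passes (D : List Letter) (τ : WordTest) (l : List DLetter) : Prop :=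
  ListLambda (τ.pre ++ l.flatMap τ.map) D

/-- Each image that contains `x` (or each image that contains `y`) also contains a letter that is
simple in `D`. -/
def Noncritical (D : List Letter) (τ : WordTest) : Prop :=
  (∀ g, x ∈ τ.map g → ∃ s ∈ τ.map g, D.count s = 1) ∨
    ∀ g, y ∈ τ.map g → ∃ s ∈ τ.map g, D.count s = 1

namespace Passes

theorem sublist {q : List Letter} {r : List DLetter} (h : τ.Passes D l)
    (hq : q.IsChain (· ≠ ·)) (hqr : q <+ r.flatMap τ.map) (hr : r <+ l) : q <+ D :=
  ListLambda.sublist h hq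
    (List.sublist_append_of_sublist_right (hqr.trans (hr.flatMap τ.map)))

theorem pair_sublist (h : τ.Passes D l) (hc : c ∈ τ.map α) (hd : d ∈ τ.map β) (hcd : c ≠ d)
    (hl : [α, β] <+ l) : [c, d] <+ D :=
  h.sublist (by simp [hcd]) (cons_sublist_append_of_mem hc (by simpa using hd)) hl

theorem mem_of_unique (h : τ.Passes D l) (hα : ∀ g, c ∈ τ.map g → g = α) (hpre : c ∉ τ.pre)
    (hD : c ∈ D) : α ∈ l := by
  have hmem := (List.mem_append.1 (h.mem_iff.2 hD)).resolve_left hpre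
  obtain ⟨g, hg, hcg⟩ := List.mem_flatMap.1 hmem
  exact hα g hcg ▸ hg

theorem pair_sublist_of_unique (h : τ.Passes D l) (hα : ∀ g, c ∈ τ.map g → g = α)
    (hβ : ∀ g, d ∈ τ.map g → g = β) (hαβ : α ≠ β) (hcd : c ≠ d) (hpre : c ∉ τ.pre)
    (hD : [c, d] <+ D) : [α, β] <+ l := by
  have himage : [c, d] <+ τ.pre ++ l.flatMap τ.map := h.symm.sublist (by simp [hcd]) hD
  rw [cons_sublist_append_iff_of_notMem hpre] at himage
  rcases pair_sublist_flatMap himage with ⟨g, k, hg, hk, hgk⟩ | ⟨g, -, hg⟩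
  · rwa [hα g hg, hβ k hk] at hgk
  · have hgα := hα g (hg.subset (by simp))
    exact absurd (hgα.symm.trans (hβ g (hg.subset (by simp)))) hαβ

end Passes

variable {pre : List Letter} {L : List (DLetter × List Letter)}

theorem mem_map_ofTable {g : DLetter} :
    c ∈ (ofTable pre L).map g ↔ ∃ W, (g, W) ∈ L ∧ c ∈ W := by
  simp only [ofTable, List.mem_flatMap, Prod.exists, List.mem_ite_nil_right]
  grind

theorem noncritical_ofTable
    (h : (∀ e ∈ L, x ∈ e.2 → ∃ s ∈ e.2, D.count s = 1) ∨
      ∀ e ∈ L, y ∈ e.2 → ∃ s ∈ e.2, D.count s = 1) : (ofTable pre L).Noncritical D := by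
  simp only [Noncritical, mem_map_ofTable]
  grind

theorem flatMap_ofTable_eq_nil (h : ∀ e ∈ L, e.1 ∉ l) : l.flatMap (ofTable pre L).map = [] := by
  rw [List.flatMap_eq_nil_iff]
  intro g hg
  rw [List.eq_nil_iff_forall_not_mem]
  intro c hc
  obtain ⟨W, hW, -⟩ := mem_map_ofTable.1 hc
  exact h _ hW hg

end WordTest

/-- A word that passes each noncritical test for `x y t x R y T` that `baseWord R T` passes. -/
def Guarded (R T : List Letter) (l : List DLetter) : Prop :=
  ∀ τ : WordTest, τ.Noncritical (cList R T) → τ.Passes (cList R T) (baseWord R T) →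
    τ.Passes (cList R T) l

theorem Guarded.passes_ofTable {R T pre : List Letter} {L : List (DLetter × List Letter)}
    {l : List DLetter} (hl : Guarded R T l)
    (hnc : (∀ e ∈ L, x ∈ e.2 → ∃ s ∈ e.2, (cList R T).count s = 1) ∨
      ∀ e ∈ L, y ∈ e.2 → ∃ s ∈ e.2, (cList R T).count s = 1)
    (hkey : ∀ e ∈ L, ∀ c, e.1 = a c ∨ e.1 = b c → c ∉ R ++ T)
    (hbase : pre ++ (baseWord [] []).flatMap (WordTest.ofTable pre L).map = cList R T) :
    (WordTest.ofTable pre L).Passes (cList R T) l := by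
  have hnil (i : Bool) {U : List Letter} (hU : U ⊆ R ++ T) :
      (U.map (copy i)).flatMap (WordTest.ofTable pre L).map = [] := by
    refine WordTest.flatMap_ofTable_eq_nil fun e he hmem => ?_
    obtain ⟨c, hc, hce⟩ := List.mem_map.1 hmem
    refine hkey e he c ?_ (hU hc)
    cases i
    · exact .inl hce.symm
    · exact .inr hce.symm
  refine hl _ (WordTest.noncritical_ofTable hnc) ?_
  have hR := List.subset_append_left R T
  have hT := List.subset_append_right R T
  have himage : (baseWord R T).flatMap (WordTest.ofTable pre L).map =
      (baseWord [] []).flatMap (WordTest.ofTable pre L).map := by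
    have hRa := hnil false hR
    have hTa := hnil false hT
    have hRb := hnil true hR
    have hTb := hnil true hT
    simp only [copy] at hRa hTa hRb hTb
    simp only [baseWord, doubleWord, List.flatMap_cons, List.flatMap_append, List.map_nil,
      List.flatMap_nil, hRa, hTa, hRb, hTb]
  rw [WordTest.Passes, show (WordTest.ofTable pre L).pre = pre from rfl, himage, hbase]
  exact ListLambda.refl _

theorem passes_proj (R T : List Letter) (i : Bool) :
    (WordTest.proj i).Passes (cList R T) (baseWord R T) := by
  have himage : (WordTest.proj i).pre ++ (baseWord R T).flatMap (WordTest.proj i).map =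
      cList R T := by
    have hnil (U : List Letter) : (U.flatMap fun _ => ([] : List Letter)) = [] := by simp
    cases i <;> simp [WordTest.proj, baseWord, doubleWord, List.flatMap_map, cList, hnil]
  rw [WordTest.Passes, himage]
  exact ListLambda.refl _

/-! ### Guarded words -/

namespace IsCBlock

variable {R T : List Letter}

theorem exists_cList_eq_head (h : IsCBlock R T) : ∃ f M S, t_ f ∈ T ∧ t_ f ∈ M ∧
    cList R T = x :: y :: t :: x :: z_ f :: (M ++ z_ f :: S) ∧ t ∉ M ∧ t ∉ S ∧ x ∉ S ∧ y ∉ S := by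
  obtain ⟨f, R', rfl⟩ := h.head_left
  have hf : t_ f ∈ T := (h.z_mem_left_iff f).1 (by simp)
  obtain ⟨A, B, rfl, -⟩ := h.split_t f hf
  refine ⟨f, R' ++ y :: (A ++ [t_ f]), B, hf, by simp, by simp [cList], ?_⟩
  have hleft : t ∉ z_ f :: R' := h.notMem_left (by simp) (by simp)
  have hright : ∀ c, (∀ i, c ≠ z_ i) → (∀ i, c ≠ t_ i) → c ∉ A ++ t_ f :: z_ f :: B :=
    fun c => h.notMem_right
  have := hright t (by simp) (by simp)
  have := hright x (by simp) (by simp)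
  have := hright y (by simp) (by simp)
  simp_all

theorem exists_cList_eq_last (h : IsCBlock R T) : ∃ k R' M S, z_ k ∈ R ∧ t_ k ∈ T ∧ t_ k ∈ M ∧
    cList R T = x :: y :: t :: x :: (R' ++ z_ k :: y :: (M ++ z_ k :: S)) ∧
    (z_ k ∉ R' ∧ y ∉ R') ∧ (x ∉ M ∧ y ∉ M ∧ z_ k ∉ M) ∧ (x ∉ S ∧ y ∉ S ∧ z_ k ∉ S) := by
  obtain ⟨k, R', rfl⟩ := h.last_left
  have hk : z_ k ∈ R' ++ [z_ k] := by simp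
  have htk := (h.z_mem_left_iff k).1 hk
  obtain ⟨A, B, rfl, -, hzA, -, hzB⟩ := h.split_t k htk
  refine ⟨k, R', A ++ [t_ k], B, hk, htk, by simp, by simp [cList], ?_⟩
  have hzR : z_ k ∉ R' := by
    have hcount := h.count_z_left k
    rw [List.count_append, List.count_singleton_self] at hcount
    exact List.count_eq_zero.1 (by omega)
  have hleft : y ∉ R' ++ [z_ k] := h.notMem_left (by simp) (by simp)
  have hright : ∀ c, (∀ i, c ≠ z_ i) → (∀ i, c ≠ t_ i) → c ∉ A ++ t_ k :: z_ k :: B :=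
    fun c => h.notMem_right
  have := hright x (by simp) (by simp)
  have := hright y (by simp) (by simp)
  simp_all

end IsCBlock

namespace Guarded

variable {R T : List Letter} {l : List DLetter} {e c : Letter}

theorem a_t_mem_and_not_sublist (h : IsCBlock R T) (hl : Guarded R T l) (he : e = x ∨ e = y) :
    a t ∈ l ∧ ¬ [b e, a x] <+ l ∧ ¬ [b e, a t] <+ l := by
  obtain ⟨f, M, S, hf, hM, hD, htM, htS, -, hyS⟩ := h.exists_cList_eq_head
  have hp := hl.passes_ofTable (pre := [])
    (L := [(a x, [x]), (a t, [y, t]), (b e, [z_ f]), (b t, M), (q, S)])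
    (.inr <| by simpa [hyS, h.count_t] using fun _ => ⟨_, hM, h.count_t_ hf⟩)
    (by rcases he with rfl | rfl <;> simp [h.notMem_left, h.notMem_right])
    (by rcases he with rfl | rfl <;> simp [baseWord, doubleWord, WordTest.ofTable, hD])
  refine ⟨hp.mem_of_unique (c := t) ?_ (by simp [WordTest.ofTable]) (by simp [cList]),
    fun hsub => ?_, fun hsub => ?_⟩
  · simp only [WordTest.mem_map_ofTable]
    grind
  · exact h.not_pair_x (by simp) (by simp) (by simp) (hp.pair_sublist
      (c := z_ f) (by simp [WordTest.mem_map_ofTable]) (by simp [WordTest.mem_map_ofTable])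
      (by simp) hsub)
  · exact h.not_pair_t (by simp) (by simp) (by simp) (hp.pair_sublist
      (c := z_ f) (by simp [WordTest.mem_map_ofTable]) (by simp [WordTest.mem_map_ofTable])
      (by simp) hsub)

theorem not_v_a_t_sublist (h : IsCBlock R T) (hl : Guarded R T l) : ¬ [v, a t] <+ l := by
  obtain ⟨f, M, S, hf, hM, hD, -, -, hxS, -⟩ := h.exists_cList_eq_head
  have hp := hl.passes_ofTable (pre := [])
    (L := [(a t, [x, y, t, x]), (v, [z_ f]), (p, M), (p', S)])
    (.inl <| by simpa [hxS, h.count_t] using fun _ => ⟨_, hM, h.count_t_ hf⟩)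
    (by simp [h.notMem_left, h.notMem_right])
    (by simp [baseWord, doubleWord, WordTest.ofTable, hD])
  exact fun hsub => h.not_pair_t (by simp) (by simp) (by simp) (hp.pair_sublist
    (c := z_ f) (by simp [WordTest.mem_map_ofTable]) (by simp [WordTest.mem_map_ofTable])
    (by simp) hsub)

theorem not_w_b_x_sublist (h : IsCBlock R T) (hl : Guarded R T l) : ¬ [w, b x] <+ l := by
  obtain ⟨f, M, S, hf, hM, hD, -, -, -, hyS⟩ := h.exists_cList_eq_head
  have hp := hl.passes_ofTable (pre := [])
    (L := [(b x, [x]), (b t, [y, t]), (w, [z_ f]), (q, M), (q', S)])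
    (.inr <| by simpa [hyS, h.count_t] using fun _ => ⟨_, hM, h.count_t_ hf⟩)
    (by simp [h.notMem_left, h.notMem_right])
    (by simp [baseWord, doubleWord, WordTest.ofTable, hD])
  exact fun hsub => h.not_pair_x (by simp) (by simp) (by simp) (hp.pair_sublist
    (c := z_ f) (by simp [WordTest.mem_map_ofTable]) (by simp [WordTest.mem_map_ofTable])
    (by simp) hsub)

theorem b_v_sublist (h : IsCBlock R T) (hl : Guarded R T l) (he : e = x ∨ e = y) :
    [b e, v] <+ l ∧ ¬ [b t, v] <+ l := by
  obtain ⟨k, R', M, S, hk, -, hM, hD, ⟨hzR, hyR⟩, ⟨hxM, hyM, hzM⟩, ⟨hxS, hyS, hzS⟩⟩ :=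
    h.exists_cList_eq_last
  have hp := hl.passes_ofTable (pre := [x])
    (L := [(v, [y]), (p, t :: x :: R'), (b e, [z_ k]), (b t, M), (q, S)])
    (.inl <| by simp [hxM, hxS, h.count_t])
    (by rcases he with rfl | rfl <;> simp [h.notMem_left, h.notMem_right])
    (by rcases he with rfl | rfl <;> simp [baseWord, doubleWord, WordTest.ofTable, hD])
  refine ⟨hp.pair_sublist_of_unique (c := z_ k) (d := y) ?_ ?_ (by simp) (by simp)
    (by simp [WordTest.ofTable]) (IsCBlock.z_y_sublist hk), fun hsub => ?_⟩
  · simp only [WordTest.mem_map_ofTable]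
    grind
  · simp only [WordTest.mem_map_ofTable]
    grind
  · exact h.not_t_y (hp.pair_sublist (c := t_ k) (d := y) (by simp [WordTest.mem_map_ofTable, hM])
      (by simp [WordTest.mem_map_ofTable]) (by simp) hsub)

theorem w_u_sublist (h : IsCBlock R T) (hl : Guarded R T l) :
    [w, u] <+ l ∧ ¬ [a t, u, w, u] <+ l := by
  obtain ⟨k, R', M, S, hk, -, -, hD, ⟨hzR, hyR⟩, ⟨hxM, hyM, hzM⟩, ⟨hxS, hyS, hzS⟩⟩ :=
    h.exists_cList_eq_last
  have hp := hl.passes_ofTable (pre := [x])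
    (L := [(u, [y]), (a t, t :: x :: R'), (w, [z_ k]), (q, M), (q', S)])
    (.inl <| by simp [hxM, hxS, h.count_t])
    (by simp [h.notMem_left, h.notMem_right])
    (by simp [baseWord, doubleWord, WordTest.ofTable, hD])
  refine ⟨hp.pair_sublist_of_unique (c := z_ k) (d := y) ?_ ?_ (by simp) (by simp)
    (by simp [WordTest.ofTable]) (IsCBlock.z_y_sublist hk), fun hsub => ?_⟩
  · simp only [WordTest.mem_map_ofTable]
    grind
  · simp only [WordTest.mem_map_ofTable]
    grind
  · have htyzy : [t, y, z_ k, y] <+ cList R T := hp.sublist (by simp) (by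
      simp [WordTest.ofTable]) hsub
    exact h.not_t_y_y ((((List.sublist_cons_self (z_ k) _).cons_cons y).cons_cons t).trans htyzy)

end Guarded

/-- The test that replaces `α`, `β`, `γ` by `x`, `y t`, `y t_j` and projects all other letters to a
copy of the alphabet from which `x`, `y`, `t` and `t_j` are deleted. -/
def WordTest.block (i : Bool) (j : ℕ) (α β γ : DLetter) : WordTest where
  pre := []
  map g := if g = α then [x] else if g = β then [y, t] else if g = γ then [y, t_ j] else
    ((WordTest.proj i).map g).filter (· ∉ [x, y, t, t_ j])

section BlockTest

variable {R T : List Letter} {l : List DLetter} {c : Letter} {α β γ : DLetter} {i : Bool} {j : ℕ}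

theorem noncritical_block (h : IsCBlock R T) (hj : t_ j ∈ T) :
    (WordTest.block i j α β γ).Noncritical (cList R T) := by
  refine .inr fun g hg => ?_
  have ht := h.count_t
  have htj := h.count_t_ hj
  simp only [WordTest.block] at hg ⊢
  split_ifs at hg ⊢ <;> simp_all

theorem filter_left (h : IsCBlock R T) (j : ℕ) :
    R.filter (· ∉ [x, y, t, t_ j]) = R := by
  rw [List.filter_eq_self]
  intro c hc
  rcases h.mem_left c hc with ⟨i, rfl⟩ | ⟨k, rfl⟩ <;> simp

theorem filter_right (h : IsCBlock R (t_ j :: T)) :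
    (t_ j :: T).filter (· ∉ [x, y, t, t_ j]) = T := by
  obtain ⟨_ | ⟨c, A⟩, B, hT, hA, -, hB, -⟩ := h.split_t j (by simp)
  · obtain ⟨-, rfl⟩ := List.cons.inj hT
    rw [List.filter_cons_of_neg (by simp), List.filter_eq_self]
    intro c hc
    have hcT := h.mem_right c (List.mem_cons_of_mem _ hc)
    grind
  · obtain ⟨rfl, -⟩ := List.cons.inj hT
    simp at hA

theorem block_map_copy {k : Bool} (hc : copy k c ∉ [α, β, γ]) :
    (WordTest.block i j α β γ).map (copy k c) =
      if k = i then [c].filter (· ∉ [x, y, t, t_ j]) else [] := by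
  simp only [List.mem_cons, List.not_mem_nil, or_false, not_or] at hc
  simp only [WordTest.block, if_neg hc.1, if_neg hc.2.1, if_neg hc.2.2]
  cases i <;> cases k <;> rfl

theorem flatMap_map_block {U : List Letter} {k : Bool} (hU : ∀ c ∈ U, copy k c ∉ [α, β, γ]) :
    (U.map (copy k)).flatMap (WordTest.block i j α β γ).map =
      if k = i then U.filter (· ∉ [x, y, t, t_ j]) else [] := by
  induction U with
  | nil => simp
  | cons c U ih =>
    rw [List.forall_mem_cons] at hU
    rw [List.map_cons, List.flatMap_cons, ih hU.2, block_map_copy hU.1]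
    split_ifs
    · rw [← List.filter_append, List.singleton_append]
    · rfl

theorem block_a_passes (h : IsCBlock R (t_ j :: T)) :
    (WordTest.block false j v p p').Passes (cList R (t_ j :: T)) (baseWord R (t_ j :: T)) := by
  have himage {U : List Letter} (k : Bool) := @flatMap_map_block v p p' false j U k
    (by cases k <;> simp [copy])
  have hRa := himage (U := R) false
  have hTa := himage (U := t_ j :: T) false
  have hRb := himage (U := R) true
  have hTb := himage (U := t_ j :: T) true
  simp only [copy, filter_left h, filter_right h, if_true, if_false, reduceCtorEq]
    at hRa hTa hRb hTb
  rw [WordTest.Passes]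
  convert ListLambda.refl _
  simp only [baseWord, doubleWord, List.flatMap_cons, List.flatMap_append, hRa, hRb, hTa, hTb]
  simp [WordTest.block, WordTest.proj, cList]

theorem block_b_passes (h : IsCBlock R (t_ j :: T)) :
    (WordTest.block true j u (a t) q).Passes (cList R (t_ j :: T)) (baseWord R (t_ j :: T)) := by
  have himage {U : List Letter} (hU : t ∉ U) (k : Bool) := @flatMap_map_block u (a t) q true j U k
    (fun c hc => by cases k <;> simp [copy, ne_of_mem_of_not_mem hc hU])
  have hRa := himage (U := R) (h.notMem_left (by simp) (by simp)) false
  have hTa := himage (U := t_ j :: T) (h.notMem_right (by simp) (by simp)) false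
  have hRb := himage (U := R) (h.notMem_left (by simp) (by simp)) true
  have hTb := himage (U := t_ j :: T) (h.notMem_right (by simp) (by simp)) true
  simp only [copy, filter_left h, filter_right h, if_true, if_false, reduceCtorEq]
    at hRa hTa hRb hTb
  rw [WordTest.Passes]
  convert ListLambda.refl _
  simp only [baseWord, doubleWord, List.flatMap_cons, List.flatMap_append, hRa, hRb, hTa, hTb]
  simp [WordTest.block, WordTest.proj, cList]

theorem not_pair_of_block_passes (h : IsCBlock R T)
    (hp : (WordTest.block i j α β γ).Passes (cList R T) l) (hc : c ∈ R)
    (hcα : copy i c ∉ [α, β, γ]) :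
    ¬ [copy i c, α] <+ l := by
  have hblock : c ∉ [x, y, t, t_ j] := by
    rcases h.mem_left c hc with ⟨i, rfl⟩ | ⟨k, rfl⟩ <;> simp
  have hne : c ≠ x ∧ c ≠ y ∧ c ≠ t := by simp_all
  refine fun hsub => h.not_pair_x hne.1 hne.2.1 hne.2.2 (hp.pair_sublist (c := c) (d := x)
    ?_ (by simp [WordTest.block]) hne.1 hsub)
  rw [block_map_copy hcα, if_pos rfl, List.mem_filter]
  exact ⟨List.mem_singleton_self c, decide_eq_true hblock⟩

theorem Guarded.not_a_v_sublist (h : IsCBlock R T) (hl : Guarded R T l) (hc : c ∈ R) :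
    ¬ [a c, v] <+ l := by
  obtain ⟨j, T', rfl⟩ := h.head_right
  exact not_pair_of_block_passes h (hl _ (noncritical_block h (by simp)) (block_a_passes h)) hc
    (by simp [copy])

theorem Guarded.not_b_u_sublist (h : IsCBlock R T) (hl : Guarded R T l) (hc : c ∈ R) :
    ¬ [b c, u] <+ l := by
  obtain ⟨j, T', rfl⟩ := h.head_right
  exact not_pair_of_block_passes h (hl _ (noncritical_block h (by simp)) (block_b_passes h)) hc
    (by simp [copy])

end BlockTest

/-! ### Critical frames -/

namespace WordTest

variable {i : Bool} {D q : List Letter} {l : List DLetter} {c d : Letter} {g : DLetter}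

theorem proj_map_copy (i : Bool) (c : Letter) : (proj i).map (copy i c) = [c] := by
  cases i <;> rfl

theorem eq_copy_of_mem_proj_map (hc : c ∈ (proj i).map g) : g = copy i c := by
  cases i <;> cases g <;> simp_all [proj, copy]

namespace Passes

theorem of_copies_sublist (hp : (proj i).Passes D l) (hq : q.IsChain (· ≠ ·))
    (h : q.map (copy i) <+ l) : q <+ D :=
  ListLambda.sublist hp hq (sublist_flatMap_of_map_sublist (fun c _ => proj_map_copy i c) h)

theorem copy_mem (hp : (proj i).Passes D l) (hc : c ∈ D) : copy i c ∈ l :=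
  hp.mem_of_unique (fun _ => eq_copy_of_mem_proj_map) List.not_mem_nil hc

theorem copy_pair_sublist (hp : (proj i).Passes D l) (hcd : c ≠ d) (h : [c, d] <+ D) :
    [copy i c, copy i d] <+ l :=
  hp.pair_sublist_of_unique (fun _ => eq_copy_of_mem_proj_map) (fun _ => eq_copy_of_mem_proj_map)
    ((copy_injective i).ne hcd) hcd List.not_mem_nil h

variable {R T : List Letter} {U A M W : List DLetter}

theorem copy_z_mem {j : ℕ} (h : IsCBlock R T) (hp : (proj i).Passes (cList R T) (U ++ W))
    (hU : [copy i y, copy i x, copy i y] <+ U) (hj : z_ j ∈ R) : copy i (z_ j) ∈ U := by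
  by_contra hz
  have hzy := hp.copy_pair_sublist (by simp) (IsCBlock.z_y_sublist hj)
  rw [cons_sublist_append_iff_of_notMem hz] at hzy
  have hsub : [y, x, y, z_ j, y] <+ cList R T :=
    hp.of_copies_sublist (by simp) (hU.append hzy)
  exact h.not_y_y_y (.trans (by simp) hsub)

theorem not_x_and_y_mem (h : IsCBlock R T)
    (hp : (proj i).Passes (cList R T) (U ++ (A ++ (M ++ (A ++ W))))) :
    ¬ (copy i x ∈ A ∧ copy i y ∈ A) := by
  rintro ⟨hx, hy⟩
  rcases pair_sublist_or_pair_sublist ((copy_injective i).ne (by simp)) hx hy with hxy | hyx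
  · obtain ⟨f, R', rfl⟩ := h.head_left
    have hassoc : U ++ (A ++ (M ++ (A ++ W))) = (U ++ (A ++ (M ++ A))) ++ W := by simp
    have hyxy : [copy i y, copy i x, copy i y] <+ U ++ (A ++ (M ++ A)) :=
      List.sublist_append_of_sublist_right (cons_sublist_append_of_mem hy
        (List.sublist_append_of_sublist_right hxy))
    have hz := copy_z_mem h (hassoc ▸ hp) hyxy List.mem_cons_self
    have hz' : copy i (z_ f) ∈ U ++ (A ++ M) := by
      simp only [List.mem_append] at hz ⊢
      tauto
    refine h.not_pair_x (c := z_ f) (by simp) (by simp) (by simp)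
      (hp.of_copies_sublist (by simp) ?_)
    rw [show U ++ (A ++ (M ++ (A ++ W))) = (U ++ (A ++ M)) ++ (A ++ W) by simp]
    exact cons_sublist_append_of_mem hz' (by simp [hx])
  · have hsub : [y, x, y, x] <+ cList R T := hp.of_copies_sublist (by simp)
      (List.sublist_append_of_sublist_right (hyx.append (List.sublist_append_of_sublist_right
        (hyx.trans (List.sublist_append_left _ _)))))
    exact h.not_y_y_x (.trans (by simp) hsub)

end Passes

end WordTest

theorem SwapFrame.fill_append_eq {α : Type*} (F : SwapFrame α) : F.fill (F.X ++ F.Y) =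
    (F.P ++ (F.X ++ (F.Y ++ (F.Q ++ (F.X ++ (F.B ++ F.Y)))))) ++ F.S := by
  simp [fill]

/-- The property that a frame with the factors `X` and `Y` gives an identity whose left-hand side
is mapped by the projection to the `i`-th copy to a word in relation `λ` with `x y t x R y T`, and
that `X` and `Y` contain the `i`-th copies of `x` and `y`. -/
structure Critical (i : Bool) (R T : List Letter) (F : SwapFrame DLetter) : Prop where
  passes : (WordTest.proj i).Passes (cList R T) (F.fill (F.X ++ F.Y))
  x_mem : copy i x ∈ F.X
  y_mem : copy i y ∈ F.Y

namespace Critical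

variable {i : Bool} {R T : List Letter} {F : SwapFrame DLetter} {c : Letter} {g : DLetter}

theorem pair_sublist_fill (hF : Critical i R T F) (hg : g ∈ F.P ++ (F.X ++ (F.Y ++ F.Q))) :
    [g, copy i x] <+ F.fill (F.X ++ F.Y) := by
  rw [show F.fill (F.X ++ F.Y) =
    (F.P ++ (F.X ++ (F.Y ++ F.Q))) ++ (F.X ++ (F.B ++ (F.Y ++ F.S))) by simp [SwapFrame.fill]]
  exact cons_sublist_append_of_mem hg (by simp [hF.x_mem])

theorem copy_notMem (hF : Critical i R T F) (h : IsCBlock R T) (hx : c ≠ x) (hy : c ≠ y)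
    (ht : c ≠ t) : copy i c ∉ F.P ++ (F.X ++ (F.Y ++ F.Q)) := fun hc =>
  h.not_pair_x hx hy ht
    (hF.passes.of_copies_sublist (q := [c, x]) (by simp [hx]) (hF.pair_sublist_fill hc))

theorem y_x_y_sublist (hF : Critical i R T F) : [copy i y, copy i x, copy i y] <+
    F.P ++ (F.X ++ (F.Y ++ (F.Q ++ (F.X ++ (F.B ++ F.Y))))) := by
  have hX := hF.x_mem
  have hY := hF.y_mem
  solve_by_elim (maxDepth := 20) [cons_sublist_append_of_mem,
    List.sublist_append_of_sublist_right, List.singleton_sublist.2]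

theorem copy_z_mem {j : ℕ} (hF : Critical i R T F) (h : IsCBlock R T) (hj : z_ j ∈ R) :
    copy i (z_ j) ∈ F.B := by
  have hz := (F.fill_append_eq ▸ hF.passes).copy_z_mem h hF.y_x_y_sublist hj
  have hnot := hF.copy_notMem h (c := z_ j) (by simp) (by simp) (by simp)
  simp only [List.mem_append] at hz hnot
  tauto

theorem copy_y_notMem {k : ℕ} (hF : Critical i R T F) (h : IsCBlock R T) :
    copy i (y_ k) ∉ F.S := by
  intro hk
  have hsub : [y, x, y, y_ k] <+ cList R T := hF.passes.of_copies_sublist (by simp)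
    (F.fill_append_eq ▸ hF.y_x_y_sublist.append (List.singleton_sublist.2 hk))
  exact h.not_y_y_y_ (k := k) (.trans (by simp) hsub)

theorem copy_y_mem {k : ℕ} (hF : Critical i R T F) (h : IsCBlock R T) (hk : y_ k ∈ R) :
    copy i (y_ k) ∈ F.B := by
  have hmem := hF.passes.copy_mem (c := y_ k) (by simp [cList, hk])
  have hnot := hF.copy_notMem h (c := y_ k) (by simp) (by simp) (by simp)
  have hS := hF.copy_y_notMem h (k := k)
  simp only [SwapFrame.fill, List.mem_append] at hmem hnot
  tauto

end Critical

/-- The property that each letter between the two factors of a frame occurs in `S`, in `V` or in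
one of the squares `(sq k)²`, which stand between the factors and of which there are as many as
squares `y_k²` in `R`. -/
structure SwapConfig (R : List Letter) (F : SwapFrame DLetter) (V : List DLetter)
    (sq : {k // y_ k ∈ R} → List DLetter) : Prop where
  mem_cases : ∀ g ∈ F.B, g ∈ F.S ∨ g ∈ V ∨ ∃ k, g ∈ sq k
  square_sublist : ∀ k, sq k ++ sq k <+ F.B
  subset : V ⊆ F.P ∨ V ⊆ F.Q

namespace SwapConfig

variable {i : Bool} {R T : List Letter} {F : SwapFrame DLetter} {V : List DLetter}
  {sq : {k // y_ k ∈ R} → List DLetter} {α β : DLetter}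

theorem sublist_fill {p M : List DLetter} (hp : p <+ F.B) : p <+ F.fill M := by
  unfold SwapFrame.fill
  solve_by_elim (maxDepth := 20) [List.sublist_append_of_sublist_right,
    List.sublist_append_of_sublist_left]

theorem exists_copy_y_mem_square (hC : SwapConfig R F V sq) (hF : Critical i R T F)
    (h : IsCBlock R T) (k : {k // y_ k ∈ R}) : ∃ m, copy i (y_ k) ∈ sq m := by
  rcases hC.mem_cases _ (hF.copy_y_mem h k.2) with hS | hV | hsq
  · exact absurd hS (hF.copy_y_notMem h)
  · have hnot := hF.copy_notMem h (c := y_ k) (by simp) (by simp) (by simp)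
    simp only [List.mem_append, not_or] at hnot
    rcases hC.subset with hP | hQ
    · exact absurd (hP hV) hnot.1
    · exact absurd (hQ hV) hnot.2.2.2
  · exact hsq

theorem eq_of_copy_y_mem_square (hC : SwapConfig R F V sq) (hF : Critical i R T F)
    (h : IsCBlock R T) {k k' m : {k // y_ k ∈ R}} (hk : copy i (y_ k) ∈ sq m)
    (hk' : copy i (y_ k') ∈ sq m) : k = k' := by
  by_contra hne
  have hneL : y_ (k : ℕ) ≠ y_ k' := by simpa [Subtype.ext_iff] using hne
  have hfill := sublist_fill (M := F.X ++ F.Y) (hC.square_sublist m)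
  rcases pair_sublist_or_pair_sublist ((copy_injective i).ne hneL) hk hk' with hkk' | hk'k
  · exact h.not_y_c_y_ k.2 hneL.symm (hF.passes.of_copies_sublist (by simp [hneL, hneL.symm])
      ((hkk'.append (List.singleton_sublist.2 hk)).trans hfill))
  · exact h.not_y_c_y_ k'.2 hneL (hF.passes.of_copies_sublist (by simp [hneL, hneL.symm])
      ((hk'k.append (List.singleton_sublist.2 hk')).trans hfill))

theorem exists_mem_square (hC : SwapConfig R F V sq) (hF : Critical i R T F)
    (h : IsCBlock R T) (m : {k // y_ k ∈ R}) : ∃ k : {k // y_ k ∈ R}, copy i (y_ k) ∈ sq m := by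
  choose f hf using hC.exists_copy_y_mem_square hF h
  have hfinite : Finite {k // y_ k ∈ R} :=
    R.finite_toSet.preimage (fun _ _ _ _ hkk' => Letter.y_.inj hkk')
  have hinj : Function.Injective f := fun k k' hkk' =>
    hC.eq_of_copy_y_mem_square hF h (hf k) (hkk' ▸ hf k')
  obtain ⟨k, rfl⟩ := Finite.surjective_of_injective hinj m
  exact ⟨k, hf k⟩

theorem separator (hC : SwapConfig R F V sq) (hF : Critical i R T F) (h : IsCBlock R T)
    (hαx : ¬ [α, copy i x] <+ F.fill (F.X ++ F.Y)) (hαβ : [α, β] <+ F.fill (F.X ++ F.Y))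
    (hβ : ∀ c ∈ R, ¬ [copy i c, β] <+ F.fill (F.X ++ F.Y)) :
    [α, β] <+ F.B ∧ β ∈ V ∧ β ∉ F.S ∧ ∀ k, β ∉ sq k := by
  obtain ⟨f, R', hR⟩ := h.head_left
  have hf : z_ f ∈ R := by simp [hR]
  have hX := hF.x_mem
  have hz := hF.copy_z_mem h hf
  have hβYS : β ∉ F.Y ++ F.S := fun hmem => hβ _ hf (by
    unfold SwapFrame.fill
    solve_by_elim (maxDepth := 20) [cons_sublist_append_of_mem,
      List.sublist_append_of_sublist_right, List.singleton_sublist.2])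
  have hβS : β ∉ F.S := fun hmem => hβYS (List.mem_append_right _ hmem)
  have hβsq (m) : β ∉ sq m := by
    intro hmem
    obtain ⟨k, hk⟩ := hC.exists_mem_square hF h m
    exact hβ _ k.2 (sublist_fill ((cons_sublist_append_of_mem hk
      (List.singleton_sublist.2 hmem)).trans (hC.square_sublist m)))
  have hα : α ∉ F.P ++ (F.X ++ (F.Y ++ (F.Q ++ F.X))) := fun hmem =>
    hαx (hF.pair_sublist_fill (by simp only [List.mem_append] at hmem ⊢; tauto))
  rw [show F.fill (F.X ++ F.Y) =
      (F.P ++ (F.X ++ (F.Y ++ (F.Q ++ F.X)))) ++ (F.B ++ (F.Y ++ F.S)) by simp [SwapFrame.fill],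
    cons_sublist_append_iff_of_notMem hα] at hαβ
  have hB := pair_sublist_of_append_of_notMem hβYS hαβ
  refine ⟨hB, ?_, hβS, hβsq⟩
  rcases hC.mem_cases β (hB.subset (by simp)) with hS | hV | ⟨k, hk⟩
  · exact absurd hS hβS
  · exact hV
  · exact absurd hk (hβsq k)

theorem not_critical_true (hC : SwapConfig R F V sq) (h : IsCBlock R T) (hV : V ⊆ F.Q)
    (hl : Guarded R T (F.fill (F.X ++ F.Y))) : ¬ Critical true R T F := by
  intro hF
  obtain ⟨hwu, htuwu⟩ := hl.w_u_sublist h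
  obtain ⟨hwuB, huV, -⟩ := hC.separator hF h (hl.not_w_b_x_sublist h) hwu
    fun c hc => hl.not_b_u_sublist h hc
  obtain ⟨ht, -, hxt⟩ := hl.a_t_mem_and_not_sublist h (.inl rfl)
  have : u ∈ F.Q := hV huV
  have hX : b x ∈ F.X := hF.x_mem
  unfold SwapFrame.fill at ht htuwu hxt
  have htP : a t ∈ F.P ++ F.X := by
    by_contra htP
    simp only [List.mem_append, not_or, List.append_assoc] at ht htP hxt
    refine hxt (List.sublist_append_of_sublist_right
      (cons_sublist_append_of_mem hX (List.singleton_sublist.2 ?_)))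
    simp only [List.mem_append]
    tauto
  apply htuwu
  rw [← List.append_assoc, ← List.append_assoc F.P]
  solve_by_elim (maxDepth := 20) [cons_sublist_append_of_mem, List.mem_append_left,
    List.sublist_append_of_sublist_right, List.sublist_append_of_sublist_left]

theorem not_critical_false (hC : SwapConfig R F V sq) (h : IsCBlock R T) (hV : V ⊆ F.P)
    (hl : Guarded R T (F.fill (F.X ++ F.Y))) : ¬ Critical false R T F := by
  intro hF
  obtain ⟨ht, hxx, -⟩ := hl.a_t_mem_and_not_sublist h (.inl rfl)
  obtain ⟨-, hvV, -⟩ := hC.separator hF h hxx (hl.b_v_sublist h (.inl rfl)).1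
    fun c hc => hl.not_a_v_sublist h hc
  rcases List.mem_append.1 ht with htP | ht
  · refine h.not_t_y_x (hF.passes.of_copies_sublist (by simp) ?_)
    exact cons_sublist_append_of_mem htP (cons_sublist_append_of_mem
      (List.mem_append_right _ hF.y_mem) (List.sublist_append_of_sublist_right
        (cons_sublist_append_of_mem hF.x_mem (List.nil_sublist _))))
  · exact hl.not_v_a_t_sublist h (cons_sublist_append_of_mem (hV hvV) (List.singleton_sublist.2 ht))

variable {A₁ A₂ N S₁ S₂ S₃ : List DLetter}

theorem v_mem_and_b_mem (hC : SwapConfig R F V sq) (h : IsCBlock R T)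
    (hB : F.B = A₂ ++ (A₁ ++ (V ++ N))) (hN : ∀ g ∈ N, g ∈ F.S ∨ ∃ k, g ∈ sq k) (hV : V ⊆ F.Q)
    (hl : Guarded R T (F.fill (F.X ++ F.Y))) (hF : Critical false R T F) {e : Letter}
    (he : e = x ∨ e = y) : v ∈ V ∧ (b e ∈ A₂ ∨ b e ∈ A₁) := by
  have hex := (hl.a_t_mem_and_not_sublist h he).2.1
  obtain ⟨hevB, hvV, hvS, hvsq⟩ := hC.separator hF h hex (hl.b_v_sublist h he).1
    fun c hc => hl.not_a_v_sublist h hc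
  have hvN : v ∉ N := fun hv => (hN v hv).elim hvS fun ⟨k, hk⟩ => hvsq k hk
  have hev : [b e, v] <+ (A₂ ++ (A₁ ++ V)) ++ N := by simpa [hB] using hevB
  have hmem := (pair_sublist_of_append_of_notMem hvN hev).subset List.mem_cons_self
  have heV : b e ∉ V := fun heV => hex (hF.pair_sublist_fill (by simp [hV heV]))
  simp only [List.mem_append] at hmem
  exact ⟨hvV, by tauto⟩

theorem not_critical_false_of_passes (hC : SwapConfig R F V sq) (h : IsCBlock R T)
    (hB : F.B = A₂ ++ (A₁ ++ (V ++ N))) (hS : F.S = S₁ ++ (A₁ ++ (S₂ ++ (A₂ ++ S₃))))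
    (hN : ∀ g ∈ N, g ∈ F.S ∨ ∃ k, g ∈ sq k) (hV : V ⊆ F.Q)
    (hl : Guarded R T (F.fill (F.X ++ F.Y)))
    (hp : (WordTest.proj true).Passes (cList R T) (F.fill (F.X ++ F.Y))) :
    ¬ Critical false R T F := by
  intro hF
  have hfill : F.fill (F.X ++ F.Y) = (F.P ++ (F.X ++ (F.Y ++ (F.Q ++ F.X)))) ++ (A₂ ++ (A₁ ++
      (V ++ (N ++ (F.Y ++ (S₁ ++ (A₁ ++ (S₂ ++ (A₂ ++ S₃))))))))) := by
    simp [SwapFrame.fill, hB, hS]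
  obtain ⟨hv, hx⟩ := hC.v_mem_and_b_mem h hB hN hV hl hF (.inl rfl)
  obtain ⟨-, hy⟩ := hC.v_mem_and_b_mem h hB hN hV hl hF (.inr rfl)
  have htv := (hl.b_v_sublist h (.inl rfl)).2
  rw [hfill] at hp htv
  generalize F.P ++ (F.X ++ (F.Y ++ (F.Q ++ F.X))) = U at hp htv
  rcases hx with hx | hx <;> rcases hy with hy | hy
  · exact WordTest.Passes.not_x_and_y_mem (U := U)
      (M := A₁ ++ (V ++ (N ++ (F.Y ++ (S₁ ++ (A₁ ++ S₂)))))) (W := S₃) h (by simpa using hp)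
      ⟨hx, hy⟩
  · refine h.not_y_y_x (ListLambda.sublist_of_not_firstTwoAdjacent hp
      IsCBlock.not_firstTwoAdjacent_y (by simp) (List.sublist_append_of_sublist_right
        (sublist_flatMap_of_map_sublist (ι := b) (fun c _ => WordTest.proj_map_copy true c) ?_)))
    simp only [List.map_cons, List.map_nil]
    solve_by_elim (maxDepth := 20) [cons_sublist_append_of_mem, List.nil_sublist,
      List.sublist_append_of_sublist_right]
  · have ht : b t ∈ U ++ (A₂ ++ A₁) ++
        (V ++ (N ++ (F.Y ++ (S₁ ++ (A₁ ++ (S₂ ++ (A₂ ++ S₃))))))) := by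
      simpa [copy] using hp.copy_mem (c := t) (by simp [cList])
    rcases List.mem_append.1 ht with ht | ht
    · apply htv
      rw [← List.append_assoc A₂, ← List.append_assoc U]
      exact cons_sublist_append_of_mem ht (cons_sublist_append_of_mem hv (List.nil_sublist _))
    · refine h.not_y_x_t (hp.of_copies_sublist (by simp) ?_)
      exact List.sublist_append_of_sublist_right (cons_sublist_append_of_mem hy
        (cons_sublist_append_of_mem hx (List.singleton_sublist.2 ht)))
  · exact WordTest.Passes.not_x_and_y_mem (U := U ++ A₂)
      (M := V ++ (N ++ (F.Y ++ S₁))) (W := S₂ ++ (A₂ ++ S₃)) h (by simpa using hp) ⟨hx, hy⟩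

end SwapConfig

/-! ### Invariance of the tests under interchanges -/

/-- The words that are guarded and pass the projection to the `i`-th copy. -/
def GuardedProj (i : Bool) (R T : List Letter) (l : List DLetter) : Prop :=
  Guarded R T l ∧ (WordTest.proj i).Passes (cList R T) l

namespace SwapConfig

variable {i : Bool} {R T : List Letter} {F : SwapFrame DLetter} {V M : List DLetter}
  {sq : {k // y_ k ∈ R} → List DLetter} {τ : WordTest}

theorem two_le_count (hC : SwapConfig R F V sq) {g : DLetter} (hg : g ∈ F.B) :
    2 ≤ (F.fill M).count g := by
  have hB : 0 < F.B.count g := List.count_pos_iff.2 hg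
  simp only [SwapFrame.fill, List.count_append]
  rcases hC.mem_cases g hg with hS | hV | ⟨k, hk⟩
  · have := List.count_pos_iff.2 hS
    omega
  · rcases hC.subset with hP | hQ
    · have := List.count_pos_iff.2 (hP hV)
      omega
    · have := List.count_pos_iff.2 (hQ hV)
      omega
  · have := List.count_pos_iff.2 hk
    have hsq := (hC.square_sublist k).count_le g
    rw [List.count_append] at hsq
    omega

theorem lambdaFilling (hC : SwapConfig R F V sq) (hM : ∀ g, g ∈ M ↔ g ∈ F.X ∨ g ∈ F.Y)
    (hp : τ.Passes (cList R T) (F.fill M)) :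
    LambdaFilling R T (F.bind τ.pre [] τ.map) (M.flatMap τ.map) where
  lambda := by rwa [SwapFrame.fill_bind, List.append_nil]
  mem_iff c := by
    simp only [SwapFrame.bind, List.mem_flatMap, hM, or_and_right, exists_or]
  not_simple c hc := by
    obtain ⟨g, hg, hcg⟩ := List.mem_flatMap.1 hc
    have hcount := two_le_count_flatMap (hC.two_le_count (M := M) hg) hcg
    rw [SwapFrame.fill_bind, List.append_nil, List.count_append]
    omega

theorem flatMap_append_comm_or_mem (hC : SwapConfig R F V sq) (h : IsCBlock R T)
    (hp : τ.Passes (cList R T) (F.fill (F.X ++ F.Y))) :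
    (F.X ++ F.Y).flatMap τ.map = (F.Y ++ F.X).flatMap τ.map ∨
      (x ∈ F.X.flatMap τ.map ∧ y ∈ F.Y.flatMap τ.map) := by
  simpa only [SwapFrame.bind, List.flatMap_append] using
    (hC.lambdaFilling (fun _ => List.mem_append) hp).append_comm_or_mem h

theorem passes_swap (hC : SwapConfig R F V sq) (h : IsCBlock R T)
    (hp : τ.Passes (cList R T) (F.fill (F.X ++ F.Y)))
    (hxy : ¬ (x ∈ F.X.flatMap τ.map ∧ y ∈ F.Y.flatMap τ.map)) :
    τ.Passes (cList R T) (F.fill (F.Y ++ F.X)) := by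
  have hcomm := (hC.flatMap_append_comm_or_mem h hp).resolve_right hxy
  simp only [WordTest.Passes, SwapFrame.fill, List.flatMap_append] at hp hcomm ⊢
  rwa [← hcomm]

theorem passes_of_swapped (hC : SwapConfig R F V sq) (h : IsCBlock R T)
    (hp : τ.Passes (cList R T) (F.fill (F.Y ++ F.X))) :
    τ.Passes (cList R T) (F.fill (F.X ++ F.Y)) := by
  have H := hC.lambdaFilling (fun _ => List.mem_append.trans or_comm) hp
  rw [List.flatMap_append] at H
  have hcomm := H.append_comm_of_swapped h
  simp only [WordTest.Passes, SwapFrame.fill, SwapFrame.bind, List.flatMap_append] at hp hcomm ⊢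
  rwa [hcomm]

theorem not_mem_of_noncritical (hC : SwapConfig R F V sq) (hτ : τ.Noncritical (cList R T))
    (hp : τ.Passes (cList R T) (F.fill (F.X ++ F.Y))) :
    ¬ (x ∈ F.X.flatMap τ.map ∧ y ∈ F.Y.flatMap τ.map) := by
  rintro ⟨hx, hy⟩
  have H := hC.lambdaFilling (fun _ => List.mem_append) hp
  rcases hτ with hτ | hτ
  · obtain ⟨g, hg, hxg⟩ := List.mem_flatMap.1 hx
    obtain ⟨s, hsg, hs⟩ := hτ g hxg
    exact (H.mem_of_simple hs).1 (List.mem_flatMap.2 ⟨g, hg, hsg⟩)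
  · obtain ⟨g, hg, hyg⟩ := List.mem_flatMap.1 hy
    obtain ⟨s, hsg, hs⟩ := hτ g hyg
    exact (H.mem_of_simple hs).2.1 (List.mem_flatMap.2 ⟨g, hg, hsg⟩)

theorem guarded_iff (hC : SwapConfig R F V sq) (h : IsCBlock R T) :
    Guarded R T (F.fill (F.X ++ F.Y)) ↔ Guarded R T (F.fill (F.Y ++ F.X)) :=
  ⟨fun hl τ hτ hbase =>
    hC.passes_swap h (hl τ hτ hbase) (hC.not_mem_of_noncritical hτ (hl τ hτ hbase)),
    fun hl τ hτ hbase => hC.passes_of_swapped h (hl τ hτ hbase)⟩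

theorem passes_proj_iff (hC : SwapConfig R F V sq) (h : IsCBlock R T)
    (hF : ¬ Critical i R T F) : (WordTest.proj i).Passes (cList R T) (F.fill (F.X ++ F.Y)) ↔
      (WordTest.proj i).Passes (cList R T) (F.fill (F.Y ++ F.X)) := by
  refine ⟨fun hp => hC.passes_swap h hp ?_, hC.passes_of_swapped h⟩
  rintro ⟨hx, hy⟩
  obtain ⟨g, hg, hxg⟩ := List.mem_flatMap.1 hx
  obtain ⟨k, hk, hyk⟩ := List.mem_flatMap.1 hy
  obtain rfl := WordTest.eq_copy_of_mem_proj_map hxg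
  obtain rfl := WordTest.eq_copy_of_mem_proj_map hyk
  exact hF ⟨hp, hg, hk⟩

theorem guardedProj_iff (hC : SwapConfig R F V sq) (h : IsCBlock R T)
    (hF : Guarded R T (F.fill (F.X ++ F.Y)) → ¬ Critical i R T F) :
    GuardedProj i R T (F.fill (F.X ++ F.Y)) ↔ GuardedProj i R T (F.fill (F.Y ++ F.X)) := by
  rw [GuardedProj, GuardedProj, ← hC.guarded_iff h]
  exact and_congr_right fun hl => hC.passes_proj_iff h (hF hl)

end SwapConfig

/-! ### Substitutions -/

/-- The frame with the factors `x` and `y` in `doubleWord R T X₁ X₂`, the hole being `X₁`. -/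
def leftFrame (R T : List Letter) (X₂ : List DLetter) : SwapFrame DLetter where
  P := [u]
  Q := [a t, v, p]
  X := [a x]
  B := X₂ ++ v :: R.map a
  Y := [a y]
  S := p' :: (T.map a ++ (b t :: b x :: w :: u :: (R.map b ++ (b y :: q :: w :: q' :: T.map b))))

/-- The frame with the factors `x'` and `y'` in `doubleWord R T X₁ X₂`, the hole being `X₂`. -/
def rightFrame (R T : List Letter) (X₁ : List DLetter) : SwapFrame DLetter where
  P := u :: (X₁ ++ [a t, v, p, a x])
  Q := v :: (R.map a ++ (a y :: p' :: (T.map a ++ [b t])))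
  X := [b x]
  B := w :: u :: R.map b
  Y := [b y]
  S := q :: w :: q' :: T.map b

section Substitution

variable {R T : List Letter}

theorem fill_leftFrame (X₁ X₂ : List DLetter) :
    (leftFrame R T X₂).fill X₁ = doubleWord R T X₁ X₂ := by
  simp [SwapFrame.fill, leftFrame, doubleWord]

theorem fill_rightFrame (X₁ X₂ : List DLetter) :
    (rightFrame R T X₁).fill X₂ = doubleWord R T X₁ X₂ := by
  simp [SwapFrame.fill, rightFrame, doubleWord]

namespace IsCBlock

variable (h : IsCBlock R T) (ι : Letter → DLetter) (φ : DLetter → List DLetter)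
include h

theorem mem_flatMap_map {g : DLetter} (hg : g ∈ (R.map ι).flatMap φ) :
    g ∈ (T.map ι).flatMap φ ∨ ∃ k : {k // y_ k ∈ R}, g ∈ φ (ι (y_ k)) := by
  rw [List.flatMap_map] at hg
  obtain ⟨c, hc, hg⟩ := List.mem_flatMap.1 hg
  rcases h.mem_left c hc with ⟨i, rfl⟩ | ⟨k, rfl⟩
  · have hi := (h.z_mem_right_iff i).2 ((h.z_mem_left_iff i).1 hc)
    exact .inl (List.mem_flatMap.2 ⟨_, List.mem_map_of_mem hi, hg⟩)
  · exact .inr ⟨⟨k, hc⟩, hg⟩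

theorem square_sublist_flatMap_map (k : {k // y_ k ∈ R}) :
    φ (ι (y_ k)) ++ φ (ι (y_ k)) <+ (R.map ι).flatMap φ := by
  obtain ⟨A, B, hR, -⟩ := h.split_y k k.2
  have hsub : [y_ (k : ℕ), y_ k] <+ R := by
    conv_rhs => rw [hR]
    simp
  simpa using (hsub.map ι).flatMap φ

end IsCBlock

variable (r s : List DLetter) (φ : DLetter → List DLetter)

theorem swapConfig_leftFrame (h : IsCBlock R T) {X₂ : List DLetter} (hX₂ : X₂ ⊆ [b x, b y]) :
    SwapConfig R ((leftFrame R T X₂).bind r s φ) (φ v) fun k => φ (a (y_ k)) where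
  mem_cases g hg := by
    simp only [SwapFrame.bind, leftFrame, List.flatMap_append, List.flatMap_cons,
      List.mem_append] at hg ⊢
    rcases hg with hg | hg | hg
    · obtain ⟨c, hc, hgc⟩ := List.mem_flatMap.1 hg
      have hcxy := hX₂ hc
      simp only [List.mem_cons, List.not_mem_nil, or_false] at hcxy
      rcases hcxy with rfl | rfl <;> tauto
    · tauto
    · have := h.mem_flatMap_map a φ hg
      tauto
  square_sublist k := by
    simp only [SwapFrame.bind, leftFrame, List.flatMap_append, List.flatMap_cons]
    exact List.sublist_append_of_sublist_right (List.sublist_append_of_sublist_right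
      (h.square_sublist_flatMap_map a φ k))
  subset := .inr fun g hg => by simp [SwapFrame.bind, leftFrame, hg]

theorem swapConfig_rightFrame (h : IsCBlock R T) (X₁ : List DLetter) :
    SwapConfig R ((rightFrame R T X₁).bind r s φ) (φ u) fun k => φ (b (y_ k)) where
  mem_cases g hg := by
    simp only [SwapFrame.bind, rightFrame, List.flatMap_append, List.flatMap_cons,
      List.mem_append] at hg ⊢
    rcases hg with hg | hg | hg
    · tauto
    · tauto
    · have := h.mem_flatMap_map b φ hg
      tauto
  square_sublist k := by
    simp only [SwapFrame.bind, rightFrame, List.flatMap_cons]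
    exact List.sublist_append_of_sublist_right (List.sublist_append_of_sublist_right
      (h.square_sublist_flatMap_map b φ k))
  subset := .inl fun g hg => by simp [SwapFrame.bind, rightFrame, hg]

theorem doubleWord_flatMap_left (α β : DLetter) (X₂ : List DLetter) :
    r ++ ((doubleWord R T [α, β] X₂).flatMap φ ++ s) =
      ((leftFrame R T X₂).bind r s φ).fill ([α].flatMap φ ++ [β].flatMap φ) := by
  rw [← List.flatMap_append, SwapFrame.fill_bind, fill_leftFrame, List.singleton_append]

theorem doubleWord_flatMap_right (α β : DLetter) (X₁ : List DLetter) :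
    r ++ ((doubleWord R T X₁ [α, β]).flatMap φ ++ s) =
      ((rightFrame R T X₁).bind r s φ).fill ([α].flatMap φ ++ [β].flatMap φ) := by
  rw [← List.flatMap_append, SwapFrame.fill_bind, fill_rightFrame, List.singleton_append]

theorem guardedProj_true_left_iff (h : IsCBlock R T) {X₂ : List DLetter}
    (hX₂ : X₂ ⊆ [b x, b y]) :
    GuardedProj true R T (r ++ ((doubleWord R T [a x, a y] X₂).flatMap φ ++ s)) ↔
      GuardedProj true R T (r ++ ((doubleWord R T [a y, a x] X₂).flatMap φ ++ s)) := by
  have hC := swapConfig_leftFrame r s φ h hX₂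
  simp only [doubleWord_flatMap_left]
  exact hC.guardedProj_iff h (hC.not_critical_true h
    fun g hg => by simp [SwapFrame.bind, leftFrame, hg])

theorem guardedProj_false_right_iff (h : IsCBlock R T) (X₁ : List DLetter) :
    GuardedProj false R T (r ++ ((doubleWord R T X₁ [b x, b y]).flatMap φ ++ s)) ↔
      GuardedProj false R T (r ++ ((doubleWord R T X₁ [b y, b x]).flatMap φ ++ s)) := by
  have hC := swapConfig_rightFrame r s φ h X₁
  simp only [doubleWord_flatMap_right]
  exact hC.guardedProj_iff h (hC.not_critical_false h
    fun g hg => by simp [SwapFrame.bind, rightFrame, hg])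

theorem passes_proj_false_left_iff (h : IsCBlock R T)
    (hl : GuardedProj true R T (r ++ ((doubleWord R T [a x, a y] [b y, b x]).flatMap φ ++ s))) :
    (WordTest.proj false).Passes (cList R T)
        (r ++ ((doubleWord R T [a x, a y] [b y, b x]).flatMap φ ++ s)) ↔
      (WordTest.proj false).Passes (cList R T)
        (r ++ ((doubleWord R T [a y, a x] [b y, b x]).flatMap φ ++ s)) := by
  have hC := swapConfig_leftFrame (T := T) (X₂ := [b y, b x]) r s φ h (by simp)
  simp only [doubleWord_flatMap_left] at hl ⊢
  refine hC.passes_proj_iff h (hC.not_critical_false_of_passes h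
    (A₁ := φ (b x)) (A₂ := φ (b y)) (N := (R.map a).flatMap φ)
    (S₁ := φ p' ++ ((T.map a).flatMap φ ++ φ (b t)))
    (S₂ := φ w ++ (φ u ++ (R.map b).flatMap φ))
    (S₃ := φ q ++ (φ w ++ (φ q' ++ ((T.map b).flatMap φ ++ s))))
    ?_ ?_ (fun g hg => ?_) (fun g hg => ?_) hl.1 hl.2)
  · simp [SwapFrame.bind, leftFrame]
  · simp [SwapFrame.bind, leftFrame]
  · refine (h.mem_flatMap_map a φ hg).imp_left fun hT => ?_
    simp only [SwapFrame.bind, leftFrame, List.flatMap_append, List.flatMap_cons, List.mem_append]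
    tauto
  · simp [SwapFrame.bind, leftFrame, hg]

end Substitution

/-! ### Varieties generated by syntactic monoids -/

namespace MonoidVariety

/-- The variety that is defined by the identity `e.1 ≈ e.2`. A variety `V` satisfies this identity
if `V ≤ ofIdentity e`. -/
def ofIdentity (e : Word × Word) : MonoidVariety where
  carrier := {M | SatisfiesIdentity M e}
  equational := ⟨{e}, by simp⟩

theorem generatedBy_le_iff {M : Type} [Monoid M] {V : MonoidVariety} :
    generatedBy M ≤ V ↔ MonCat.of M ∈ V.carrier :=
  ⟨fun h => h fun _ hW => hW, fun h _ hN => hN V h⟩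

theorem le_of_forall_le_ofIdentity {V W : MonoidVariety}
    (h : ∀ e, W ≤ ofIdentity e → V ≤ ofIdentity e) : V ≤ W := by
  obtain ⟨E, hE⟩ := W.equational
  intro M hM
  rw [hE]
  refine fun e he => h e (fun N hN => ?_) hM
  rw [hE] at hN
  exact hN e he

theorem le_ofIdentity_symm {V : MonoidVariety} {u v : Word} (h : V ≤ ofIdentity (u, v)) :
    V ≤ ofIdentity (v, u) :=
  fun _ hM φ => (h hM φ).symm

theorem le_ofIdentity_trans {V : MonoidVariety} {u v w : Word} (huv : V ≤ ofIdentity (u, v))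
    (hvw : V ≤ ofIdentity (v, w)) : V ≤ ofIdentity (u, w) :=
  fun _ hM φ => (huv hM φ).trans (hvw hM φ)

end MonoidVariety

open MonoidVariety

/-- The syntactic congruence of a set of words. -/
def syntacticCon {α : Type} (K : Set (FreeMonoid α)) : Con (FreeMonoid α) where
  r u v := ∀ p s, p * u * s ∈ K ↔ p * v * s ∈ K
  iseqv :=
    { refl := fun _ _ _ => Iff.rfl
      symm := fun h p s => (h p s).symm
      trans := fun h h' p s => (h p s).trans (h' p s) }
  mul' {u v u' v'} h h' p s := by
    have huv := h p (u' * s)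
    have huv' := h' (p * v) s
    simp only [mul_assoc] at huv huv' ⊢
    exact huv.trans huv'

/-- The variety generated by the syntactic monoid of a set of words. -/
def syntacticVariety {α : Type} (K : Set (FreeMonoid α)) : MonoidVariety :=
  generatedBy (syntacticCon K).Quotient

section SyntacticVariety

variable {α β : Type}

theorem syntacticVariety_le_ofIdentity_iff {K : Set (FreeMonoid α)} {e : Word × Word} :
    syntacticVariety K ≤ ofIdentity e ↔
      ∀ Φ : Word →* FreeMonoid α, syntacticCon K (Φ e.1) (Φ e.2) := by
  have hlift (Φ : Word →* FreeMonoid α) :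
      FreeMonoid.lift (fun c => (Φ (FreeMonoid.of c) : (syntacticCon K).Quotient)) =
        (syntacticCon K).mk'.comp Φ := FreeMonoid.hom_eq fun c => by simp
  refine generatedBy_le_iff.trans ⟨fun h Φ => ?_, fun h φ => ?_⟩
  · have hΦ := h fun c => (Φ (FreeMonoid.of c) : (syntacticCon K).Quotient)
    rw [hlift] at hΦ
    exact (Con.eq _).1 hΦ
  · choose ψ hψ using fun c => Con.mk'_surjective (c := syntacticCon K) (φ c)
    obtain rfl : (fun c => (syntacticCon K).mk' (ψ c)) = φ := funext hψ
    have hψ' := hlift (FreeMonoid.lift ψ)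
    simp only [FreeMonoid.lift_eval_of] at hψ'
    simp only [Con.coe_mk', hψ']
    exact (Con.eq _).2 (h (FreeMonoid.lift ψ))

theorem syntacticVariety_le_ofIdentity_map_iff {K : Set (FreeMonoid α)} {ε : β → Letter}
    (hε : ε.Injective) {l l' : FreeMonoid β} :
    syntacticVariety K ≤ ofIdentity (FreeMonoid.map ε l, FreeMonoid.map ε l') ↔
      ∀ Ψ : FreeMonoid β →* FreeMonoid α, syntacticCon K (Ψ l) (Ψ l') := by
  refine syntacticVariety_le_ofIdentity_iff.trans
    ⟨fun h Ψ => ?_, fun h Φ => h (Φ.comp (FreeMonoid.map ε))⟩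
  have hΨ : (FreeMonoid.lift (Function.extend ε (fun g => Ψ (FreeMonoid.of g)) 1)).comp
      (FreeMonoid.map ε) = Ψ := FreeMonoid.hom_eq fun g => by simp [hε.extend_apply]
  have := h (FreeMonoid.lift (Function.extend ε (fun g => Ψ (FreeMonoid.of g)) 1))
  simpa only [← MonoidHom.comp_apply, hΨ] using this

theorem syntacticVariety_iInter_le {ι : Sort*} {K : ι → Set (FreeMonoid α)} {V : MonoidVariety}
    (h : ∀ i, syntacticVariety (K i) ≤ V) : syntacticVariety (⋂ i, K i) ≤ V := by
  refine le_of_forall_le_ofIdentity fun e he => syntacticVariety_le_ofIdentity_iff.2 fun Φ p s => ?_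
  simp only [Set.mem_iInter]
  exact forall_congr' fun i => syntacticVariety_le_ofIdentity_iff.1 ((h i).trans he) Φ p s

theorem syntacticVariety_inter_le (K L : Set (FreeMonoid α)) :
    syntacticVariety (K ∩ L) ≤ syntacticVariety K ⊔ syntacticVariety L := by
  rw [Set.inter_eq_iInter]
  refine syntacticVariety_iInter_le fun i => ?_
  cases i
  · exact le_sup_right
  · exact le_sup_left

theorem syntacticVariety_translate_le (K : Set (FreeMonoid β)) (q : FreeMonoid β)
    (σ : FreeMonoid α →* FreeMonoid β) :
    syntacticVariety {u | q * σ u ∈ K} ≤ syntacticVariety K := by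
  refine le_of_forall_le_ofIdentity fun e he => syntacticVariety_le_ofIdentity_iff.2 fun Φ p s => ?_
  simpa only [Set.mem_ofPred_eq, map_mul, mul_assoc, MonoidHom.comp_apply] using
    syntacticVariety_le_ofIdentity_iff.1 he (σ.comp Φ) (q * σ p) (σ s)

theorem syntacticVariety_lambda_class_le (w : Word) :
    syntacticVariety {u | lambdaCon u w} ≤ varMLambda w := by
  refine le_of_forall_le_ofIdentity fun e he => syntacticVariety_le_ofIdentity_iff.2 fun Φ p s => ?_
  have hφ := generatedBy_le_iff.1 he fun c => (((Φ (FreeMonoid.of c) : Word) :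
    lambdaCon.Quotient) : MAlpha lambdaCon {(w : lambdaCon.Quotient)})
  have hlift : FreeMonoid.lift (fun c => (((Φ (FreeMonoid.of c) : Word) :
      lambdaCon.Quotient) : MAlpha lambdaCon {(w : lambdaCon.Quotient)})) =
      (Con.mk' _).comp (lambdaCon.mk'.comp Φ) := FreeMonoid.hom_eq fun c => by simp
  have hmem (u : Word) (hu : lambdaCon (p * u * s) w) :
      (u : lambdaCon.Quotient) ∈ factorClosure {(w : lambdaCon.Quotient)} :=
    ⟨w, rfl, p, s, ((Con.eq _).2 hu).symm⟩
  rw [hlift] at hφ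
  rcases (Con.eq _).1 hφ with heq | ⟨hu, hv⟩
  · have hcongr := lambdaCon.mul (lambdaCon.mul (lambdaCon.refl p) ((Con.eq _).1 heq))
      (lambdaCon.refl s)
    exact ⟨lambdaCon.trans (lambdaCon.symm hcongr), lambdaCon.trans hcongr⟩
  · exact iff_of_false (fun h => hu (hmem _ h)) fun h => hv (hmem _ h)

end SyntacticVariety

/-! ### A pentagon of subvarieties -/

theorem le_sup_inf_of_isModularLattice_Iic {α : Type*} [Lattice α] {a b c d : α}
    [IsModularLattice (Set.Iic a)] (hb : b ≤ a) (hc : c ≤ a) (hd : d ≤ c ⊔ b) :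
    d ≤ c ⊔ b ⊓ (c ⊔ d) := by
  have hda : d ≤ a := hd.trans (sup_le hc hb)
  have hmod := IsModularLattice.sup_inf_le_assoc_of_le (α := Set.Iic a) (x := ⟨c, hc⟩) ⟨b, hb⟩
    (z := ⟨c ⊔ d, sup_le hc hda⟩) (show c ≤ c ⊔ d from le_sup_left)
  exact (le_inf hd le_sup_right).trans hmod

theorem not_isModularLattice_of_identities {V A B C : MonoidVariety} {u₀₀ u₁₀ u₀₁ u₁₁ : Word}
    (hAV : A ≤ V) (hBV : B ≤ V) (hC : C ≤ A ⊔ B)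
    (hA₀ : A ≤ ofIdentity (u₀₀, u₁₀)) (hA₁ : A ≤ ofIdentity (u₀₁, u₁₁))
    (hB₀ : B ≤ ofIdentity (u₀₀, u₀₁)) (hB₁ : B ≤ ofIdentity (u₁₀, u₁₁))
    (hC₁ : C ≤ ofIdentity (u₀₁, u₁₁)) (hC₀ : ¬ C ≤ ofIdentity (u₀₀, u₁₀)) :
    ¬ IsModularLattice (SubvarietyLattice V) := by
  intro hmod
  have hACB : B ⊓ (A ⊔ C) ≤ ofIdentity (u₀₀, u₁₀) :=
    le_ofIdentity_trans (inf_le_left.trans hB₀) (le_ofIdentity_trans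
      (inf_le_right.trans (sup_le hA₁ hC₁)) (le_ofIdentity_symm (inf_le_left.trans hB₁)))
  exact hC₀ ((le_sup_inf_of_isModularLattice_Iic hBV hAV hC).trans (sup_le hA₀ hACB))

theorem toList_monoidHom_apply {α β : Type} (Ψ : FreeMonoid β →* FreeMonoid α)
    (l : FreeMonoid β) : (Ψ l).toList = l.toList.flatMap fun g => (Ψ (FreeMonoid.of g)).toList := by
  induction l with
  | one => simp
  | of g => simp
  | mul u v hu hv => simp [hu, hv]

theorem syntacticVariety_passes_le (w : Word) (τ : WordTest) :
    syntacticVariety {l : FreeMonoid DLetter | τ.Passes w.toList l.toList} ≤ varMLambda w := by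
  have htest : {l : FreeMonoid DLetter | τ.Passes w.toList l.toList} =
      {l | FreeMonoid.ofList τ.pre * FreeMonoid.lift (fun g => FreeMonoid.ofList (τ.map g)) l ∈
        {u | lambdaCon u w}} := by
    ext l
    have hlift := toList_monoidHom_apply (FreeMonoid.lift fun g => FreeMonoid.ofList (τ.map g)) l
    simp only [FreeMonoid.lift_eval_of, FreeMonoid.toList_ofList] at hlift
    rw [Set.mem_ofPred_eq, Set.mem_ofPred_eq, Set.mem_ofPred_eq, WordTest.Passes, ListLambda,
      ← hlift]
    rfl
  rw [htest]
  exact (syntacticVariety_translate_le _ _ _).trans (syntacticVariety_lambda_class_le w)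

section Pentagon

variable {R T : List Letter} {w : Word} {ε : DLetter → Letter}

/-- The set of words over `DLetter` that are guarded and pass the projection to the `i`-th copy. -/
def guardedSet (i : Bool) (R T : List Letter) : Set (FreeMonoid DLetter) :=
  {l | GuardedProj i R T l.toList}

theorem syntacticVariety_guardedSet_le (hw : w.toList = cList R T) (i : Bool) :
    syntacticVariety (guardedSet i R T) ≤ varMLambda w := by
  have hset : guardedSet i R T = (⋂ τ : WordTest, ⋂ _ : τ.Noncritical w.toList,
      ⋂ _ : τ.Passes w.toList (baseWord R T), {l | τ.Passes w.toList l.toList}) ∩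
      {l | (WordTest.proj i).Passes w.toList l.toList} := by
    ext l
    simp only [guardedSet, GuardedProj, Guarded, hw, Set.mem_inter_iff, Set.mem_iInter,
      Set.mem_ofPred_eq]
  rw [hset]
  exact (syntacticVariety_inter_le _ _).trans (sup_le
    (syntacticVariety_iInter_le fun τ => syntacticVariety_iInter_le fun _ =>
      syntacticVariety_iInter_le fun _ => syntacticVariety_passes_le w τ)
    (syntacticVariety_passes_le w _))

theorem exists_injective_letter : ∃ ε : DLetter → Letter, ε.Injective := by
  obtain ⟨f, hf⟩ := exists_injective_nat DLetter
  exact ⟨fun g => z_ (f g), fun _ _ h => hf (Letter.z_.inj h)⟩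

/-- The word `doubleWord R T X₁ X₂`, with the letters of `DLetter` replaced by letters of the
original alphabet. -/
def encodedWord (ε : DLetter → Letter) (R T : List Letter) (X₁ X₂ : List DLetter) : Word :=
  FreeMonoid.map ε (FreeMonoid.ofList (doubleWord R T X₁ X₂))

theorem mul_mul_mem_guardedSet_iff {i : Bool} {r l s : FreeMonoid DLetter}
    {Ψ : FreeMonoid DLetter →* FreeMonoid DLetter} :
    r * Ψ l * s ∈ guardedSet i R T ↔ GuardedProj i R T (r.toList ++
      ((l.toList.flatMap fun g => (Ψ (FreeMonoid.of g)).toList) ++ s.toList)) := by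
  rw [guardedSet, Set.mem_ofPred_eq, FreeMonoid.toList_mul, FreeMonoid.toList_mul,
    toList_monoidHom_apply, List.append_assoc]

theorem guardedSet_true_le_ofIdentity (h : IsCBlock R T) (hε : ε.Injective) {X₂ : List DLetter}
    (hX₂ : X₂ ⊆ [b x, b y]) : syntacticVariety (guardedSet true R T) ≤
      ofIdentity (encodedWord ε R T [a x, a y] X₂, encodedWord ε R T [a y, a x] X₂) := by
  refine (syntacticVariety_le_ofIdentity_map_iff hε).2 fun Ψ r s => ?_
  rw [mul_mul_mem_guardedSet_iff, mul_mul_mem_guardedSet_iff]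
  exact guardedProj_true_left_iff _ _ _ h hX₂

theorem guardedSet_false_le_ofIdentity (h : IsCBlock R T) (hε : ε.Injective)
    (X₁ : List DLetter) : syntacticVariety (guardedSet false R T) ≤
      ofIdentity (encodedWord ε R T X₁ [b x, b y], encodedWord ε R T X₁ [b y, b x]) := by
  refine (syntacticVariety_le_ofIdentity_map_iff hε).2 fun Ψ r s => ?_
  rw [mul_mul_mem_guardedSet_iff, mul_mul_mem_guardedSet_iff]
  exact guardedProj_false_right_iff _ _ _ h X₁

theorem guardedSet_inter_le_ofIdentity (h : IsCBlock R T) (hε : ε.Injective) :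
    syntacticVariety (guardedSet true R T ∩ guardedSet false R T) ≤
      ofIdentity (encodedWord ε R T [a x, a y] [b y, b x],
        encodedWord ε R T [a y, a x] [b y, b x]) := by
  refine (syntacticVariety_le_ofIdentity_map_iff hε).2 fun Ψ r s => ?_
  simp only [Set.mem_inter_iff, mul_mul_mem_guardedSet_iff, FreeMonoid.toList_ofList]
  have htrue := guardedProj_true_left_iff r.toList s.toList
    (fun g => (Ψ (FreeMonoid.of g)).toList) h (X₂ := [b y, b x]) (by simp)
  rw [← htrue]
  refine and_congr_right fun hl => and_congr ⟨fun _ => (htrue.1 hl).1, fun _ => hl.1⟩ ?_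
  exact passes_proj_false_left_iff _ _ _ h hl

theorem baseWord_mem_guardedSet (i : Bool) :
    FreeMonoid.ofList (baseWord R T) ∈ guardedSet i R T :=
  ⟨fun _ _ hbase => hbase, passes_proj R T i⟩

theorem swapped_notMem_guardedSet (h : IsCBlock R T) (X₂ : List DLetter) :
    FreeMonoid.ofList (doubleWord R T [a y, a x] X₂) ∉ guardedSet false R T := by
  rintro ⟨-, hp⟩
  refine h.not_y_x_t (hp.of_copies_sublist (by simp) ?_)
  simp [copy, doubleWord]

theorem not_guardedSet_inter_le_ofIdentity (h : IsCBlock R T) (hε : ε.Injective) :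
    ¬ syntacticVariety (guardedSet true R T ∩ guardedSet false R T) ≤
      ofIdentity (encodedWord ε R T [a x, a y] [b x, b y],
        encodedWord ε R T [a y, a x] [b x, b y]) := by
  intro hle
  have hid := (syntacticVariety_le_ofIdentity_map_iff hε).1 hle (MonoidHom.id _) 1 1
  simp only [MonoidHom.id_apply, one_mul, mul_one] at hid
  exact swapped_notMem_guardedSet h _
    (hid.1 ⟨baseWord_mem_guardedSet true, baseWord_mem_guardedSet false⟩).2

end Pentagon

theorem mainTheorem10_general {R T : List Letter} (h : IsCBlock R T) {w : Word}
    (hw : w.toList = cList R T) :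
    ¬ IsModularLattice (MonoidVariety.SubvarietyLattice (varMLambda w)) := by
  obtain ⟨ε, hε⟩ := exists_injective_letter
  exact not_isModularLattice_of_identities
    (syntacticVariety_guardedSet_le hw true) (syntacticVariety_guardedSet_le hw false)
    (syntacticVariety_inter_le _ _)
    (guardedSet_true_le_ofIdentity h hε (List.Subset.refl _))
    (guardedSet_true_le_ofIdentity h hε (by simp))
    (guardedSet_false_le_ofIdentity h hε _) (guardedSet_false_le_ofIdentity h hε _)
    (guardedSet_inter_le_ofIdentity h hε) (not_guardedSet_inter_le_ofIdentity h hε)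

end

/-- For all `n ≥ 1` and `ρ ∈ S_n`, the lattice of subvarieties of the variety generated by
`M_λ([c_{0,0,n}[ρ]]^λ)` is not modular. -/
theorem mainTheorem10 (n : ℕ) (hn : 1 ≤ n) (ρ : SymGroup n) :
    ¬ IsModularLattice (MonoidVariety.SubvarietyLattice (varMLambda (cWord n ρ))) :=
  mainTheorem10_general (isCBlock_cWord hn ρ) (toList_cWord n ρ)
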